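/- Consider $K$-armed stochastic bandits in which all arms have reward distributions $\nu_\theta$, $\theta=(\mu,\sigma)\in\mathbb R\times\mathbb R_+$, from one location-scale model: either the uniform model (density $\sigma^{-1}\mathbf 1[\mu-\sigma/2\le x\le\mu+\sigma/2]$) or the Gaussian model (mean $\mu$, standard deviation $\sigma$), with both parameters unknown. Thompson sampling (TS) with a prior on $(\mu,\sigma)$, possibly improper, first plays every arm $n_0$ times and then, in every round, draws $(\tilde\mu_i,\tilde\sigma_i)$ independently from the posterior of each arm $i$ given the rewards observed from that arm, and plays an arm with the largest $\tilde\mu_i$. Let $\mathrm{Reg}(T)=\sum_{t=1}^T\Delta_{j(t)}$, where $j(t)$ is the arm played at round $t$ and $\Delta_i=\mu_{i^\star}-\mu_i$ for the optimal arm $i^\star$. An algorithm is called asymptotically optimal for a model if, on every instance (with any finite number of arms) that has a unique optimal arm $i^\star$, $$\limsup_{T\to\infty}\frac{\mathbb E[\mathrm{Reg}(T)]}{\log T}\le\sum_{i\ne i^\star}\frac{\Delta_i}{\inf\{\mathrm{KL}(\nu_{\theta_i};\nu_{\theta}) : \theta=(\mu,\sigma),\ \mu>\mu_{i^\star}\}},$$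 and suboptimal if it is not asymptotically optimal. Let $k\ge 1$ be real, and let $g:\mathbb R\to\mathbb R$ and $h:\mathbb R_+\to\mathbb R$ be one-to-one and differentiable with $g'(\mu)\propto 1$ on $\mathbb R$ and $h'(\sigma)\propto\sigma^{-k}$ on $\mathbb R_+$ (for example the location-rate parameterization $g(\mu)=\mu$, $h(\sigma)=\sigma^{-1}$, with $k=2$). Let the prior be the uniform prior in the $(g(\mu),h(\sigma))$ parameterization, that is, Lebesgue measure on the range of $(\mu,\sigma)\mapsto(g(\mu),h(\sigma))$, carried to $(\mu,\sigma)$ by the inverse map. Then TS with this prior on every arm and with $n_0=\max(2,3-\lceil k\rceil)$ initial plays of each arm is suboptimal, both for the uniform model and for the Gaussian model. -/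

import Mathlib

open MeasureTheory ProbabilityTheory Filter Topology
open scoped ENNReal

noncomputable section

namespace LSBandit

/-! ### The reward models: location-scale families -/

/-- The two reward models: uniform bandits and Gaussian bandits. -/
inductive Model
  | uniform
  | gaussian

/-- The standard density `f_{0,1}` of each model, centred so that the location parameter is the
mean: the uniform density on `[-1/2, 1/2]` and the standard normal density. -/
def baseDensity : Model → ℝ → ℝ≥0∞
  | Model.uniform => Set.indicator (Set.Icc (-(1 / 2) : ℝ) (1 / 2)) (fun _ => 1)
  | Model.gaussian => gaussianPDF 0 1

theorem measurable_baseDensity (M : Model) : Measurable (baseDensity M) := by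
  cases M with
  | uniform => exact measurable_const.indicator measurableSet_Icc
  | gaussian => exact measurable_gaussianPDF 0 1

/-- The parameter space `ℝ × ℝ₊` of pairs `θ = (μ, σ)` (location = mean, scale). -/
def paramSpace : Set (ℝ × ℝ) := Set.univ ×ˢ Set.Ioi 0

/-- The location-scale density `f_{μ,σ}(x) = σ⁻¹ f_{0,1}((x - μ) / σ)`, where `θ = (μ, σ)`. -/
def density (M : Model) (θ : ℝ × ℝ) (x : ℝ) : ℝ≥0∞ :=
  ENNReal.ofReal θ.2⁻¹ * baseDensity M ((x - θ.1) / θ.2)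

theorem measurable_density (M : Model) :
    Measurable (fun p : (ℝ × ℝ) × ℝ => density M p.1 p.2) := by
  unfold density
  exact (ENNReal.measurable_ofReal.comp (by fun_prop)).mul
    ((measurable_baseDensity M).comp (by fun_prop))

/-- The reward distribution `ν_θ`. -/
def rewardLaw (M : Model) (θ : ℝ × ℝ) : Measure ℝ :=
  volume.withDensity (density M θ)

/-! ### Bandit protocol -/

/-- A history of `t` rounds: the arm that was played and the reward that was received, for each
of the rounds `0, …, t - 1`. -/
abbrev Hist (K t : ℕ) : Type := Fin t → Fin K × ℝ

/-- A (randomized) policy for `K` arms: the conditional law of the next arm given the history. -/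
structure Policy (K : ℕ) where
  /-- the law of the arm played after a history of `t` rounds -/
  play : ∀ t : ℕ, Kernel (Hist K t) (Fin K)
  markov : ∀ t : ℕ, IsMarkovKernel (play t)

/-- The reward given the history and the arm `i` just chosen has law `ν_{θ i}`. -/
def rewardKernel (M : Model) {K : ℕ} (θ : Fin K → ℝ × ℝ) (t : ℕ) :
    Kernel (Hist K t × Fin K) ℝ :=
  (Kernel.ofFunOfCountable (fun i : Fin K => rewardLaw M (θ i))).comap Prod.snd measurable_snd

/-- The law of the first `t` rounds when the policy `π` interacts with the bandit instance whose
arm `i` has parameter `θ i`. -/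
def histLaw (M : Model) {K : ℕ} (π : Policy K) (θ : Fin K → ℝ × ℝ) :
    (t : ℕ) → Measure (Hist K t)
  | 0 => Measure.dirac Fin.elim0
  | t + 1 =>
    ((histLaw M π θ t ⊗ₘ π.play t) ⊗ₘ rewardKernel M θ t).map
      (fun p => (Fin.snoc p.1.1 (p.1.2, p.2) : Hist K (t + 1)))

/-- The expected regret `𝔼[Reg(T)]`, where `Reg(T) = ∑_{t ≤ T} Δ_{j(t)}` and
`Δ_i = μ_{i⋆} - μ_i` (nonnegative, since `i⋆` is the optimal arm). -/
def expectedRegret (M : Model) {K : ℕ} (π : Policy K) (θ : Fin K → ℝ × ℝ) (iStar : Fin K)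
    (T : ℕ) : ℝ≥0∞ :=
  ∫⁻ H, ∑ s : Fin T, ENNReal.ofReal ((θ iStar).1 - (θ (H s).1).1) ∂(histLaw M π θ T)

/-- The asymptotic regret lower bound
`∑_{i ≠ i⋆} Δ_i / inf {KL(ν_{θ_i}; ν_η) : μ(η) > μ_{i⋆}}`. -/
def lowerBound (M : Model) {K : ℕ} (θ : Fin K → ℝ × ℝ) (iStar : Fin K) : ℝ≥0∞ :=
  ∑ i ∈ Finset.univ.erase iStar,
    ENNReal.ofReal ((θ iStar).1 - (θ i).1) /
      ⨅ η ∈ {η : ℝ × ℝ | η ∈ paramSpace ∧ (θ iStar).1 < η.1},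
        InformationTheory.klDiv (rewardLaw M (θ i)) (rewardLaw M η)

/-- An algorithm (a policy for each number `K ≥ 1` of arms) is asymptotically optimal for a model
if, on each bandit instance with a unique optimal arm,
`limsup_{T → ∞} 𝔼[Reg(T)] / log T` is at most the lower bound. -/
def IsAsymptoticallyOptimal (M : Model) (alg : ∀ (K : ℕ) [NeZero K], Policy K) : Prop :=
  ∀ (K : ℕ) [NeZero K] (θ : Fin K → ℝ × ℝ) (iStar : Fin K),
    (∀ i, θ i ∈ paramSpace) → (∀ i, i ≠ iStar → (θ i).1 < (θ iStar).1) →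
    limsup (fun T : ℕ =>
        expectedRegret M (alg K) θ iStar T / ENNReal.ofReal (Real.log (T : ℝ))) atTop
      ≤ lowerBound M θ iStar

/-! ### Priors and posteriors -/

/-- The uniform prior in the `(g(μ), h(σ))` parameterization, as a (possibly infinite) measure on
the parameters `(μ, σ)`: Lebesgue measure on the set of values of `(g(μ), h(σ))`, transported to
`(μ, σ)` by the inverse of the reparameterization. -/
def uniformPrior (g h : ℝ → ℝ) : Measure (ℝ × ℝ) :=
  (volume.restrict ((fun θ : ℝ × ℝ => (g θ.1, h θ.2)) '' paramSpace)).map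
    (Function.invFunOn (fun θ : ℝ × ℝ => (g θ.1, h θ.2)) paramSpace)

instance (g h : ℝ → ℝ) : SFinite (uniformPrior g h) := by
  unfold uniformPrior; infer_instance

/-- The likelihood of `θ` for the rewards of arm `i` in the history `H`. -/
def likelihood (M : Model) {K t : ℕ} (i : Fin K) (H : Hist K t) (θ : ℝ × ℝ) : ℝ≥0∞ :=
  ∏ s : Fin t, if (H s).1 = i then density M θ (H s).2 else 1

theorem measurable_likelihood (M : Model) {K t : ℕ} (i : Fin K) :
    Measurable (fun p : Hist K t × (ℝ × ℝ) => likelihood M i p.1 p.2) := by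
  unfold likelihood
  refine Finset.measurable_prod _ fun s _ => Measurable.ite ?_ ?_ measurable_const
  · exact (measurable_fst.comp ((measurable_pi_apply s).comp measurable_fst))
      (measurableSet_singleton i)
  · exact (measurable_density M).comp (measurable_snd.prodMk
      (measurable_snd.comp ((measurable_pi_apply s).comp measurable_fst)))

/-- The normalizing constant of the posterior of arm `i`. -/
def evidence (M : Model) (prior : Measure (ℝ × ℝ)) {K t : ℕ} (i : Fin K) (H : Hist K t) : ℝ≥0∞ :=
  ∫⁻ θ, likelihood M i H θ ∂prior

open Classical in
/-- The posterior of the parameter of arm `i` given the history, for a (possibly improper) prior: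
the normalized measure `likelihood · prior`. When it cannot be normalized, it is given an
arbitrary value. -/
def posterior (M : Model) (prior : Measure (ℝ × ℝ)) {K t : ℕ} (i : Fin K) (H : Hist K t) :
    Measure (ℝ × ℝ) :=
  if evidence M prior i H = 0 ∨ evidence M prior i H = ∞ then Measure.dirac (0, 1)
  else (evidence M prior i H)⁻¹ • prior.withDensity (likelihood M i H)

instance (M : Model) (prior : Measure (ℝ × ℝ)) {K t : ℕ} (i : Fin K) (H : Hist K t) :
    IsProbabilityMeasure (posterior M prior i H) := by
  unfold posterior
  split_ifs with hZ
  · infer_instance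
  · push Not at hZ
    refine ⟨?_⟩
    rw [Measure.smul_apply, withDensity_apply _ MeasurableSet.univ, Measure.restrict_univ,
      smul_eq_mul]
    exact ENNReal.inv_mul_cancel hZ.1 hZ.2

theorem measurable_evidence (M : Model) (prior : Measure (ℝ × ℝ)) [SFinite prior] {K t : ℕ}
    (i : Fin K) : Measurable (fun H : Hist K t => evidence M prior i H) :=
  (measurable_likelihood M i).lintegral_prod_right'

theorem measurable_posterior (M : Model) (prior : Measure (ℝ × ℝ)) [SFinite prior] {K t : ℕ}
    (i : Fin K) : Measurable (fun H : Hist K t => posterior M prior i H) := by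
  have hZ := measurable_evidence M prior (t := t) i
  unfold posterior
  refine Measurable.ite ?_ measurable_const ?_
  · exact (hZ (measurableSet_singleton 0)).union (hZ (measurableSet_singleton ∞))
  · refine Measure.measurable_of_measurable_coe _ fun s hs => ?_
    simp only [Measure.smul_apply, smul_eq_mul, withDensity_apply _ hs]
    exact hZ.inv.mul ((measurable_likelihood M i).lintegral_prod_right' (ν := prior.restrict s))

/-! ### Thompson sampling -/

open Classical in
/-- The set of indices at which `m` is maximal. -/
def maximizers {K : ℕ} (m : Fin K → ℝ) : Finset (Fin K) :=
  Finset.univ.filter (fun i => ∀ j, m j ≤ m i)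

theorem maximizers_nonempty {K : ℕ} [NeZero K] (m : Fin K → ℝ) : (maximizers m).Nonempty := by
  obtain ⟨i, hi⟩ := Finite.exists_max m
  exact ⟨i, by simpa [maximizers] using hi⟩

/-- An arm with the largest value of `m` (the first one, if there are ties). -/
def argmax {K : ℕ} [NeZero K] (m : Fin K → ℝ) : Fin K :=
  (maximizers m).min' (maximizers_nonempty m)

theorem argmax_eq_iff {K : ℕ} [NeZero K] (m : Fin K → ℝ) (i : Fin K) :
    argmax m = i ↔ (∀ j, m j ≤ m i) ∧ ∀ l, (∀ j, m j ≤ m l) → i ≤ l := by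
  unfold argmax
  rw [Finset.min'_eq_iff]
  simp [maximizers]

theorem measurable_argmax {K : ℕ} [NeZero K] : Measurable (argmax (K := K)) := by
  refine measurable_to_countable' fun i => ?_
  have h : ∀ l : Fin K, MeasurableSet {m : Fin K → ℝ | ∀ j, m j ≤ m l} := fun l => by
    rw [Set.ofPred_forall]
    exact MeasurableSet.iInter fun j =>
      measurableSet_le (measurable_pi_apply j) (measurable_pi_apply l)
  have e : argmax (K := K) ⁻¹' {i} = {m | ∀ j, m j ≤ m i} ∩
      ⋂ l : Fin K, ({m | ∀ j, m j ≤ m l}ᶜ ∪ {_m | i ≤ l}) := by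
    ext m
    simp only [Set.mem_preimage, Set.mem_singleton_iff, argmax_eq_iff, Set.mem_inter_iff,
      Set.mem_iInter, Set.mem_union, Set.mem_compl_iff, Set.mem_ofPred_eq, imp_iff_not_or]
  rw [e]
  exact (h i).inter (MeasurableSet.iInter fun l => (h l).compl.union (MeasurableSet.const _))

theorem measurable_pi_posterior (M : Model) (prior : Measure (ℝ × ℝ)) [SFinite prior]
    (K t : ℕ) :
    Measurable (fun H : Hist K t => Measure.pi (fun i => posterior M prior i H)) := by
  refine Measurable.measure_of_isPiSystem_of_isProbabilityMeasure generateFrom_pi.symm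
    isPiSystem_pi ?_
  rintro _ ⟨s, hs, rfl⟩
  simp only [Measure.pi_pi]
  refine Finset.measurable_prod _ fun i _ => ?_
  have hsi : MeasurableSet (s i) := hs i (Set.mem_univ i)
  exact (Measure.measurable_coe hsi).comp (measurable_posterior M prior i)

/-- The joint law, given the history, of the independent posterior samples `(μ̃_i, σ̃_i)` of all
the arms. -/
def sampleKernel (M : Model) (prior : Measure (ℝ × ℝ)) [SFinite prior] (K t : ℕ) :
    Kernel (Hist K t) (Fin K → ℝ × ℝ) where
  toFun H := Measure.pi (fun i => posterior M prior i H)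
  measurable' := measurable_pi_posterior M prior K t

instance (M : Model) (prior : Measure (ℝ × ℝ)) [SFinite prior] (K t : ℕ) :
    IsMarkovKernel (sampleKernel M prior K t) :=
  ⟨fun H => inferInstanceAs (IsProbabilityMeasure (Measure.pi fun i => posterior M prior i H))⟩

theorem measurable_argmax_fst {K : ℕ} [NeZero K] :
    Measurable (fun p : Fin K → ℝ × ℝ => argmax fun i => (p i).1) :=
  measurable_argmax.comp
    (measurable_pi_lambda _ fun i => measurable_fst.comp (measurable_pi_apply i))

/-- The conditional law of the arm with the largest sampled mean `μ̃_i`, given the history. -/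
def sampledArm (M : Model) (prior : Measure (ℝ × ℝ)) [SFinite prior] (K : ℕ) [NeZero K]
    (t : ℕ) : Kernel (Hist K t) (Fin K) :=
  (sampleKernel M prior K t).map (fun p => argmax fun i => (p i).1)

instance (M : Model) (prior : Measure (ℝ × ℝ)) [SFinite prior] (K : ℕ) [NeZero K] (t : ℕ) :
    IsMarkovKernel (sampledArm M prior K t) :=
  Kernel.IsMarkovKernel.map _ measurable_argmax_fst

/-- Thompson sampling for `K` arms: each arm is first played `n₀` times (in cyclic order); after
that, each round draws `(μ̃_i, σ̃_i)` independently from the posterior of each arm `i` and plays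
the arm with the largest `μ̃_i`. -/
def thompsonSampling (M : Model) (prior : Measure (ℝ × ℝ)) [SFinite prior] (n₀ : ℕ)
    (K : ℕ) [NeZero K] : Policy K where
  play t :=
    if t < n₀ * K then Kernel.const _ (Measure.dirac (Fin.ofNat K t))
    else sampledArm M prior K t
  markov t := by
    split_ifs <;> infer_instance

/-- The number `n₀ = max(2, 3 - ⌈k⌉)` of initial plays of each arm under a prior `σ^{-k}`. -/
def initialPlays (k : ℝ) : ℕ := (max 2 (3 - ⌈k⌉)).toNat

end LSBandit

end

namespace LSBandit

/-! ### Location-scale families -/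

/-! The prior has density proportional to `σ^{-k}`, and `k ≥ 1` leaves only two initial plays per
arm. If two rewards of an arm lie within `δ` of each other, the scale looks tiny: the marginal
posterior of the location has polynomial tails, and its mass at distance at least `1/2` from the
rewards is of order at most `δ^k ≤ δ` (`posterior_far_le`).

Take two arms: an optimal one with parameter `(1, 8)` and a suboptimal one with parameter `(0, ε)`.
With probability at least of order `δ`, the optimal arm starts with two rewards within `δ` of each
other and far below `0` (`exists_le_starvingMass`). Each later round then plays it with probability
at most `O(δ)` plus a term that decays geometrically and accounts for atypical samples of the other
arm. Hence, for `δ` a small multiple of `1/T`, at least half of this mass still has not replayed the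
optimal arm after `T` rounds (`starvingMass_le_two_mul`). Round `T` therefore costs at least a
constant over `T`, and the regret is at least `b log T` up to a constant
(`exists_log_le_expectedRegret`).

The constant `b` comes from the optimal arm alone and does not depend on `ε`. The lower bound,
however, tends to `0` with `ε`: a law concentrated near `0` diverges more and more from every law of
mean above `1` (`exists_forall_le_klDiv`). A small `ε` separates the two rates.

Both models are treated together: their likelihoods are decreasing functions of a norm of the
centred sample divided by `σ`. -/

theorem lintegral_comp_mul_left (f : ℝ → ℝ≥0∞) (hf : Measurable f) {a : ℝ} (ha : 0 < a) :
    ∫⁻ x, f x = ENNReal.ofReal a * ∫⁻ x, f (a * x) := by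
  have h := Real.map_volume_mul_left ha.ne'
  have h2 : ∫⁻ x, f (a * x) = ∫⁻ x, f x ∂(Measure.map (a * ·) volume) := by
    rw [lintegral_map hf (by fun_prop)]
  rw [h2, h, lintegral_smul_measure, smul_eq_mul, ← mul_assoc, ← ENNReal.ofReal_mul ha.le,
    abs_of_pos (inv_pos.2 ha), mul_inv_cancel₀ ha.ne', ENNReal.ofReal_one, one_mul]

theorem setLIntegral_Ioi_comp_mul_left (f : ℝ → ℝ≥0∞) (hf : Measurable f) {a : ℝ} (ha : 0 < a) :
    ∫⁻ x in Set.Ioi 0, f x = ENNReal.ofReal a * ∫⁻ x in Set.Ioi 0, f (a * x) := by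
  rw [← lintegral_indicator measurableSet_Ioi, ← lintegral_indicator measurableSet_Ioi,
    lintegral_comp_mul_left _ (hf.indicator measurableSet_Ioi) ha]
  congr 2 with x
  by_cases hx : 0 < x
  · rw [Set.indicator_of_mem (by exact mul_pos ha hx), Set.indicator_of_mem (by exact hx)]
  · rw [Set.indicator_of_notMem, Set.indicator_of_notMem (by exact hx)]
    simp only [Set.mem_Ioi, mul_pos_iff_of_pos_left ha]
    exact hx

theorem lintegral_baseDensity (M : Model) : ∫⁻ x, baseDensity M x = 1 := by
  cases M with
  | uniform =>
    simp only [baseDensity]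
    rw [lintegral_indicator measurableSet_Icc]
    simp
    norm_num
  | gaussian => exact lintegral_gaussianPDF_eq_one 0 one_ne_zero

theorem lintegral_rewardLaw (M : Model) (m : ℝ) {σ : ℝ} (hσ : 0 < σ) (f : ℝ → ℝ≥0∞)
    (hf : Measurable f) :
    ∫⁻ x, f x ∂(rewardLaw M (m, σ)) = ∫⁻ z, baseDensity M z * f (m + σ * z) := by
  have hd : Measurable (density M (m, σ)) := (measurable_density M).comp measurable_prodMk_left
  unfold rewardLaw
  rw [lintegral_withDensity_eq_lintegral_mul _ hd hf,
    ← lintegral_add_left_eq_self _ m, lintegral_comp_mul_left _ _ hσ,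
    ← lintegral_const_mul]
  · congr 1 with z
    simp only [Pi.mul_apply, density]
    rw [← mul_assoc, ← mul_assoc, ← ENNReal.ofReal_mul hσ.le, mul_inv_cancel₀ hσ.ne']
    simp [hσ.ne']
  · exact ((hd.mul hf).comp (measurable_const_add m)).comp (measurable_const_mul σ)
  · exact ((hd.mul hf).comp (measurable_const_add m))

theorem isProbabilityMeasure_rewardLaw (M : Model) {θ : ℝ × ℝ} (hθ : θ ∈ paramSpace) :
    IsProbabilityMeasure (rewardLaw M θ) := by
  obtain ⟨m, σ⟩ := θ
  have hσ : 0 < σ := hθ.2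
  refine ⟨?_⟩
  have h := lintegral_rewardLaw M m hσ (fun _ => 1) measurable_const
  simpa [lintegral_baseDensity] using h

theorem baseDensity_mono (M : Model) {x y : ℝ} (hxy : x ≤ y) (hy : y ≤ 0) :
    baseDensity M x ≤ baseDensity M y := by
  cases M with
  | uniform =>
    simp only [baseDensity]
    by_cases hx : x ∈ Set.Icc (-(1 / 2) : ℝ) (1 / 2)
    · have : y ∈ Set.Icc (-(1 / 2) : ℝ) (1 / 2) := ⟨hx.1.trans hxy, by linarith⟩
      rw [Set.indicator_of_mem hx, Set.indicator_of_mem this]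
    · rw [Set.indicator_of_notMem hx]; exact zero_le
  | gaussian =>
    simp only [baseDensity, gaussianPDF, gaussianPDFReal]
    apply ENNReal.ofReal_le_ofReal
    have : y ^ 2 ≤ x ^ 2 := by nlinarith
    simp only [sub_zero]
    gcongr

theorem density_mono (M : Model) {m σ x y : ℝ} (hσ : 0 < σ) (hxy : x ≤ y) (hy : y ≤ m) :
    density M (m, σ) x ≤ density M (m, σ) y := by
  unfold density
  gcongr
  apply baseDensity_mono
  · simp only; gcongr
  · exact div_nonpos_of_nonpos_of_nonneg (by simp only; linarith) hσ.le

theorem density_ne_top (M : Model) (θ : ℝ × ℝ) (x : ℝ) : density M θ x ≠ ∞ := by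
  unfold density
  refine ENNReal.mul_ne_top ENNReal.ofReal_ne_top ?_
  cases M with
  | uniform => simp only [baseDensity, Set.indicator]; split_ifs <;> simp
  | gaussian => simp [baseDensity, gaussianPDF]

/-- The density increases up to the mean, which exceeds `1`. Its value `q` at `ε` bounds it above on
`[-ε, ε]` and below on `[ε, 1]`; the latter interval has length at least `1/2` and mass at most `1`,
so `q ≤ 2`. -/
theorem rewardLaw_Icc_le (M : Model) {η : ℝ × ℝ} (hη : η ∈ paramSpace) (hη1 : 1 < η.1) {ε : ℝ}
    (hε : 0 < ε) (hε2 : ε ≤ 1 / 2) :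
    rewardLaw M η (Set.Icc (-ε) ε) ≤ ENNReal.ofReal (4 * ε) := by
  obtain ⟨m, σ⟩ := η
  have hσ : 0 < σ := hη.2
  simp only at hη1
  have := isProbabilityMeasure_rewardLaw M hη
  set q := density M (m, σ) ε
  have h1 : rewardLaw M (m, σ) (Set.Icc (-ε) ε) ≤ q * ENNReal.ofReal (2 * ε) := by
    rw [rewardLaw, withDensity_apply _ measurableSet_Icc]
    calc ∫⁻ x in Set.Icc (-ε) ε, density M (m, σ) x ≤ ∫⁻ x in Set.Icc (-ε) ε, q :=
          setLIntegral_mono measurable_const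
            fun x hx => density_mono M hσ hx.2 (by linarith)
      _ = q * ENNReal.ofReal (2 * ε) := by
          rw [setLIntegral_const, Real.volume_Icc]; congr 2; ring
  have h2 : q * ENNReal.ofReal (1 / 2) ≤ 1 := by
    calc q * ENNReal.ofReal (1 / 2) ≤ q * ENNReal.ofReal (1 - ε) := by gcongr; linarith
      _ = ∫⁻ x in Set.Icc ε 1, q := by rw [setLIntegral_const, Real.volume_Icc]
      _ ≤ ∫⁻ x in Set.Icc ε 1, density M (m, σ) x :=
          setLIntegral_mono' measurableSet_Icc
            fun x hx => density_mono M hσ hx.1 (by linarith [hx.2])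
      _ = rewardLaw M (m, σ) (Set.Icc ε 1) := by
          rw [rewardLaw, withDensity_apply _ measurableSet_Icc]
      _ ≤ 1 := prob_le_one
  calc _ ≤ q * ENNReal.ofReal (2 * ε) := h1
    _ = q * ENNReal.ofReal (1 / 2) * ENNReal.ofReal (4 * ε) := by
        rw [mul_assoc, ← ENNReal.ofReal_mul (by norm_num)]; congr 2; ring
    _ ≤ 1 * ENNReal.ofReal (4 * ε) := by gcongr
    _ = _ := one_mul _

/-! ### Divergence of the optimistic alternatives -/

/-- Fenchel's inequality for `klFun`. -/
theorem mul_le_klFun_add {x : ℝ} (hx : 0 ≤ x) (a : ℝ) :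
    a * x ≤ InformationTheory.klFun x + Real.exp a := by
  rw [InformationTheory.klFun_apply]
  rcases hx.eq_or_lt with rfl | hx
  · simp; positivity
  · have h := Real.add_one_le_exp (a - Real.log x)
    rw [Real.exp_sub, Real.exp_log hx, le_div_iff₀ hx] at h
    nlinarith

/-- Fenchel's inequality for the density `dP/dQ`, integrated over `A` against `Q`. A set that is
likely under `P` and unlikely under `Q` thus forces a large divergence. -/
theorem mul_measure_le_klDiv_add {α : Type*} [MeasurableSpace α] (P Q : Measure α)
    [IsFiniteMeasure P] [IsFiniteMeasure Q] {A : Set α} {a : ℝ}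
    (ha : 0 ≤ a) :
    ENNReal.ofReal a * P A ≤ InformationTheory.klDiv P Q + ENNReal.ofReal (Real.exp a) * Q A := by
  by_cases hac : P ≪ Q
  · rw [InformationTheory.klDiv_eq_lintegral_klFun_of_ac hac]
    calc ENNReal.ofReal a * P A = ∫⁻ x in A, ENNReal.ofReal a * P.rnDeriv Q x ∂Q := by
          rw [lintegral_const_mul _ (Measure.measurable_rnDeriv _ _),
            Measure.setLIntegral_rnDeriv hac]
      _ ≤ ∫⁻ x in A, (ENNReal.ofReal (InformationTheory.klFun (P.rnDeriv Q x).toReal) +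
            ENNReal.ofReal (Real.exp a)) ∂Q := by
          refine lintegral_mono_ae (ae_restrict_of_ae ?_)
          filter_upwards [Measure.rnDeriv_lt_top P Q] with x hx
          conv_lhs => rw [← ENNReal.ofReal_toReal hx.ne]
          rw [← ENNReal.ofReal_mul ha, ← ENNReal.ofReal_add
            (InformationTheory.klFun_nonneg ENNReal.toReal_nonneg) (Real.exp_pos a).le]
          exact ENNReal.ofReal_le_ofReal (mul_le_klFun_add ENNReal.toReal_nonneg a)
      _ = ∫⁻ x in A, ENNReal.ofReal (InformationTheory.klFun (P.rnDeriv Q x).toReal) ∂Q +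
            ENNReal.ofReal (Real.exp a) * Q A := by
          rw [lintegral_add_right _ measurable_const, setLIntegral_const]
      _ ≤ _ := by
          gcongr
          exact Measure.restrict_le_self
  · rw [InformationTheory.klDiv_of_not_ac hac]; simp

theorem rewardLaw_Icc_eq (M : Model) {ε : ℝ} (hε : 0 < ε) :
    rewardLaw M (0, ε) (Set.Icc (-ε) ε) = ∫⁻ z in Set.Icc (-1) 1, baseDensity M z := by
  rw [← lintegral_indicator_one measurableSet_Icc,
    lintegral_rewardLaw M 0 hε _ (measurable_one.indicator measurableSet_Icc),
    ← lintegral_indicator measurableSet_Icc]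
  congr 1 with z
  have : (0 + ε * z ∈ Set.Icc (-ε) ε) ↔ z ∈ Set.Icc (-1 : ℝ) 1 := by
    simp only [Set.mem_Icc, zero_add]
    constructor
    · rintro ⟨h1, h2⟩; constructor <;> nlinarith
    · rintro ⟨h1, h2⟩; constructor <;> nlinarith
  by_cases hz : z ∈ Set.Icc (-1 : ℝ) 1
  · rw [Set.indicator_of_mem hz, Set.indicator_of_mem (this.2 hz)]; simp
  · rw [Set.indicator_of_notMem hz, Set.indicator_of_notMem (fun h => hz (this.1 h))]; simp

theorem baseDensity_central_pos (M : Model) :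
    0 < ∫⁻ z in Set.Icc (-1) 1, baseDensity M z := by
  have hpos : ∀ z ∈ Set.Icc (-(1 / 2) : ℝ) (1 / 2), baseDensity M z ≠ 0 := by
    intro z hz
    cases M with
    | uniform => simp only [baseDensity, Set.indicator_of_mem hz]; exact one_ne_zero
    | gaussian => exact (gaussianPDF_pos 0 one_ne_zero z).ne'
  rw [setLIntegral_pos_iff (measurable_baseDensity M)]
  refine lt_of_lt_of_le ?_ (measure_mono (s := Set.Icc (-(1 / 2) : ℝ) (1 / 2)) fun z hz =>
    ⟨hpos z hz, ⟨by linarith [hz.1], by linarith [hz.2]⟩⟩)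
  rw [Real.volume_Icc]; norm_num

/-- The divergence from `ν_{(0, ε)}` to the distributions of mean larger than `1` tends to
infinity as `ε` tends to zero. -/
theorem exists_forall_le_klDiv (M : Model) (Λ : ℝ) (hΛ : 0 < Λ) :
    ∃ ε₀ > 0, ∀ ε, 0 < ε → ε ≤ ε₀ → ∀ η ∈ paramSpace, 1 < η.1 →
      ENNReal.ofReal Λ ≤ InformationTheory.klDiv (rewardLaw M (0, ε)) (rewardLaw M η) := by
  have hρ := baseDensity_central_pos M
  have hρ1 : ∫⁻ z in Set.Icc (-1) 1, baseDensity M z ≤ 1 :=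
    (setLIntegral_le_lintegral _ _).trans (lintegral_baseDensity M).le
  set ρ := ∫⁻ z in Set.Icc (-1) 1, baseDensity M z with hρdef
  have hρt : ρ ≠ ∞ := (hρ1.trans_lt ENNReal.one_lt_top).ne
  have hr : 0 < ρ.toReal := ENNReal.toReal_pos hρ.ne' hρt
  set a := (Λ + 1) / ρ.toReal
  have ha : 0 ≤ a := by positivity
  -- The test set is `[-ε, ε]`, of mass `ρ` under `ν_{(0, ε)}` for every `ε`, and at most `4ε` under
  -- the alternative. Then `a ρ = Λ + 1`, while `ε ≤ exp (-a) / 4` keeps the error `exp a * 4ε` at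
  -- most `1`.
  refine ⟨min (1 / 2) (Real.exp (-a) / 4), by positivity, fun ε hε hε0 η hη hη1 => ?_⟩
  have hθ : ((0 : ℝ), ε) ∈ paramSpace := ⟨trivial, hε⟩
  have := isProbabilityMeasure_rewardLaw M hη
  have := isProbabilityMeasure_rewardLaw M hθ
  have h := mul_measure_le_klDiv_add (rewardLaw M (0, ε)) (rewardLaw M η) (A := Set.Icc (-ε) ε) ha
  rw [rewardLaw_Icc_eq M hε, ← hρdef] at h
  have hQ := rewardLaw_Icc_le M hη hη1 hε (hε0.trans (min_le_left _ _))
  have h1 : ENNReal.ofReal a * ρ = ENNReal.ofReal (Λ + 1) := by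
    conv_lhs => rw [← ENNReal.ofReal_toReal hρt]
    rw [← ENNReal.ofReal_mul ha, div_mul_cancel₀ _ hr.ne']
  have h2 : ENNReal.ofReal (Real.exp a) * rewardLaw M η (Set.Icc (-ε) ε) ≤ 1 := by
    calc _ ≤ ENNReal.ofReal (Real.exp a) * ENNReal.ofReal (4 * ε) := by gcongr
      _ = ENNReal.ofReal (Real.exp a * (4 * ε)) := by
          rw [ENNReal.ofReal_mul (Real.exp_pos a).le]
      _ ≤ ENNReal.ofReal 1 := by
          apply ENNReal.ofReal_le_ofReal
          have := hε0.trans (min_le_right _ _)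
          calc Real.exp a * (4 * ε) ≤ Real.exp a * Real.exp (-a) := by gcongr; linarith
            _ = 1 := by rw [← Real.exp_add]; simp
      _ = 1 := ENNReal.ofReal_one
  rw [h1, ENNReal.ofReal_add hΛ.le zero_le_one, ENNReal.ofReal_one] at h
  exact (ENNReal.add_le_add_iff_right ENNReal.one_ne_top).1 (h.trans (by gcongr))

/-! ### The prior -/

theorem ne_zero_of_injective_of_hasDerivAt {g : ℝ → ℝ} {c : ℝ} (hg_inj : Function.Injective g)
    (hg : ∀ μ : ℝ, HasDerivAt g c μ) : c ≠ 0 := by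
  rintro rfl
  have h := is_const_of_deriv_eq_zero (fun x => (hg x).differentiableAt)
    (fun x => (hg x).deriv) 0 1
  exact zero_ne_one (hg_inj h)

theorem ne_zero_of_injOn_of_hasDerivAt {h : ℝ → ℝ} {d k : ℝ} (hh_inj : Set.InjOn h (Set.Ioi 0))
    (hh : ∀ σ : ℝ, 0 < σ → HasDerivAt h (d * σ ^ (-k)) σ) : d ≠ 0 := by
  rintro rfl
  have h1 := (convex_Ioi (0 : ℝ)).norm_image_sub_le_of_norm_hasDerivWithin_le (f := h)
    (f' := fun _ => 0) (C := 0) (x := 1) (y := 2)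
    (fun x hx => by simpa using (hh x hx).hasDerivWithinAt) (by simp) (by simp) (by simp)
  simp only [zero_mul, norm_le_zero_iff, sub_eq_zero] at h1
  exact absurd (hh_inj (by simp) (by simp) h1) (by norm_num)

theorem measurableSet_paramSpace : MeasurableSet paramSpace :=
  MeasurableSet.univ.prod measurableSet_Ioi

/-- Change of variables: the Jacobian of `(μ, σ) ↦ (g μ, h σ)` is `c d σ^{-k}`. -/
theorem lintegral_uniformPrior {g h : ℝ → ℝ} {c d k : ℝ}
    (hg_inj : Function.Injective g) (hh_inj : Set.InjOn h (Set.Ioi 0))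
    (hg : ∀ μ : ℝ, HasDerivAt g c μ)
    (hh : ∀ σ : ℝ, 0 < σ → HasDerivAt h (d * σ ^ (-k)) σ)
    (φ : ℝ × ℝ → ℝ≥0∞) (hφ : Measurable φ) :
    ∫⁻ θ, φ θ ∂(uniformPrior g h) =
      ENNReal.ofReal |c * d| *
        ∫⁻ μ, ∫⁻ σ in Set.Ioi 0, ENNReal.ofReal (σ ^ (-k)) * φ (μ, σ) := by
  set f : ℝ × ℝ → ℝ × ℝ := fun θ => (g θ.1, h θ.2) with hf
  let f' : ℝ × ℝ → ℝ × ℝ →L[ℝ] ℝ × ℝ := fun θ =>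
    (c • ContinuousLinearMap.id ℝ ℝ).prodMap ((d * θ.2 ^ (-k)) • ContinuousLinearMap.id ℝ ℝ)
  have hs := measurableSet_paramSpace
  have hf' : ∀ θ ∈ paramSpace, HasFDerivWithinAt f (f' θ) paramSpace θ := by
    intro θ hθ
    have e : ∀ b : ℝ, ContinuousLinearMap.toSpanSingleton ℝ b =
        b • ContinuousLinearMap.id ℝ ℝ := fun b => by ext; simp
    have h1 := (hg θ.1).hasFDerivAt
    have h2 := (hh θ.2 hθ.2).hasFDerivAt
    rw [e] at h1 h2
    exact (h1.prodMap θ h2).hasFDerivWithinAt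
  have hinj : Set.InjOn f paramSpace := by
    intro x hx y hy hxy
    have := Prod.ext_iff.1 hxy
    exact Prod.ext (hg_inj this.1) (hh_inj hx.2 hy.2 this.2)
  have himg : MeasurableSet (f '' paramSpace) := measurable_image_of_fderivWithin hs hf' hinj
  have hleft : ∀ x ∈ paramSpace, Function.invFunOn f paramSpace (f x) = x :=
    fun x hx => hinj.leftInvOn_invFunOn hx
  have hmeas : AEMeasurable (Function.invFunOn f paramSpace)
      (volume.restrict (f '' paramSpace)) := by
    refine aemeasurable_restrict_of_measurable_subtype himg ?_
    intro B hB
    -- The inverse is measurable because preimages under it are images under `f`, and an injective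
    -- differentiable map sends measurable sets to measurable sets.
    have : (fun y : f '' paramSpace => Function.invFunOn f paramSpace y) ⁻¹' B =
        Subtype.val ⁻¹' (f '' (paramSpace ∩ B)) := by
      ext ⟨y, x, hx, rfl⟩
      simp only [Set.mem_preimage, hleft x hx]
      constructor
      · exact fun h => ⟨x, ⟨hx, h⟩, rfl⟩
      · rintro ⟨z, ⟨hz, hzB⟩, hzx⟩
        rwa [← hinj hz hx hzx]
    rw [this]
    exact measurable_subtype_coe (measurable_image_of_fderivWithin (hs.inter hB)
      (fun x hx => (hf' x hx.1).mono Set.inter_subset_left) (hinj.mono Set.inter_subset_left))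
  have hdet : ∀ θ ∈ paramSpace, ENNReal.ofReal |(f' θ).det| =
      ENNReal.ofReal |c * d| * ENNReal.ofReal (θ.2 ^ (-k)) := by
    intro θ hθ
    have : (f' θ).det = c * (d * θ.2 ^ (-k)) := by
      have : ((f' θ : ℝ × ℝ →L[ℝ] ℝ × ℝ) : ℝ × ℝ →ₗ[ℝ] ℝ × ℝ) =
        (c • LinearMap.id).prodMap ((d * θ.2 ^ (-k)) • LinearMap.id) := rfl
      rw [ContinuousLinearMap.det, this, LinearMap.det_prodMap]
      simp
    have hp : 0 < θ.2 ^ (-k) := Real.rpow_pos_of_pos hθ.2 _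
    rw [this, ← mul_assoc, abs_mul, abs_of_pos hp, ENNReal.ofReal_mul (abs_nonneg _)]
  unfold uniformPrior
  rw [lintegral_map' hφ.aemeasurable hmeas,
    lintegral_image_eq_lintegral_abs_det_fderiv_mul _ hs hf' hinj]
  have : ∀ θ ∈ paramSpace, ENNReal.ofReal |(f' θ).det| *
      φ (Function.invFunOn f paramSpace (f θ)) =
      ENNReal.ofReal |c * d| * (ENNReal.ofReal (θ.2 ^ (-k)) * φ θ) := by
    intro θ hθ
    rw [hdet θ hθ, hleft θ hθ, mul_assoc]
  rw [setLIntegral_congr_fun hs this]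
  have hm : Measurable fun θ : ℝ × ℝ => ENNReal.ofReal (θ.2 ^ (-k)) * φ θ := by fun_prop
  rw [lintegral_const_mul _ hm]
  congr 1
  rw [paramSpace, Measure.volume_eq_prod, ← Measure.prod_restrict, Measure.restrict_univ,
    lintegral_prod _ hm.aemeasurable]

/-! ### Joint densities through the spread of the sample -/

/-- The joint density of `n` standard rewards as a function of their norm: the maximum norm in the
uniform model and the root mean square in the Gaussian model. -/
noncomputable def profile : Model → ℕ → ℝ → ℝ≥0∞
  | Model.uniform, _, w => if w ≤ 1 / 2 then 1 else 0
  | Model.gaussian, n, w =>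
    ENNReal.ofReal ((√(2 * Real.pi))⁻¹ ^ n * Real.exp (-(n * w ^ 2 / 2)))

theorem measurable_profile (M : Model) (n : ℕ) : Measurable (profile M n) := by
  cases M with
  | uniform => exact Measurable.ite measurableSet_Iic measurable_const measurable_const
  | gaussian => unfold profile; fun_prop

theorem inv_sqrt_two_pi_le_one : (√(2 * Real.pi))⁻¹ ≤ 1 := by
  apply inv_le_one_of_one_le₀
  rw [Real.one_le_sqrt]
  linarith [Real.pi_gt_three]

theorem profile_le_one (M : Model) (n : ℕ) (w : ℝ) : profile M n w ≤ 1 := by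
  cases M with
  | uniform => simp only [profile]; split_ifs <;> simp
  | gaussian =>
    simp only [profile]
    rw [← ENNReal.ofReal_one]
    apply ENNReal.ofReal_le_ofReal
    apply mul_le_one₀ (pow_le_one₀ (by positivity) inv_sqrt_two_pi_le_one) (by positivity)
    rw [Real.exp_le_one_iff]
    have : 0 ≤ n * w ^ 2 / 2 := by positivity
    linarith

theorem profile_ne_zero (M : Model) (n : ℕ) {w : ℝ} (hw : w ≤ 1 / 2) : profile M n w ≠ 0 := by
  cases M with
  | uniform => simp only [profile, if_pos hw]; exact one_ne_zero
  | gaussian => simp only [profile]; rw [← pos_iff_ne_zero, ENNReal.ofReal_pos]; positivity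

/-- The norm of the sample `(x s - m)_{s ∈ S}` is at most `w`. -/
def SpreadLE {ι : Type*} : Model → Finset ι → (ι → ℝ) → ℝ → ℝ → Prop
  | Model.uniform, S, x, m, w => ∀ s ∈ S, |x s - m| ≤ w
  | Model.gaussian, S, x, m, w => ∑ s ∈ S, (x s - m) ^ 2 ≤ S.card * w ^ 2

/-- The norm of the sample `(x s - m)_{s ∈ S}` is at least `w`. -/
def SpreadGE {ι : Type*} : Model → Finset ι → (ι → ℝ) → ℝ → ℝ → Prop
  | Model.uniform, S, x, m, w => ∃ s ∈ S, w ≤ |x s - m|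
  | Model.gaussian, S, x, m, w => S.card * w ^ 2 ≤ ∑ s ∈ S, (x s - m) ^ 2

theorem prod_density_gaussian {ι : Type*} (S : Finset ι) (x : ι → ℝ) (m σ : ℝ) :
    ∏ s ∈ S, density Model.gaussian (m, σ) (x s) = ENNReal.ofReal σ⁻¹ ^ S.card *
      ENNReal.ofReal ((√(2 * Real.pi))⁻¹ ^ S.card *
        Real.exp (-((∑ s ∈ S, (x s - m) ^ 2) / σ ^ 2 / 2))) := by
  simp only [density, baseDensity, gaussianPDF, gaussianPDFReal]
  rw [Finset.prod_mul_distrib, Finset.prod_const, ← ENNReal.ofReal_prod_of_nonneg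
    (fun _ _ => by positivity), Finset.prod_mul_distrib, Finset.prod_const, ← Real.exp_sum]
  congr 4
  · simp
  · rw [Finset.sum_div, Finset.sum_div, ← Finset.sum_neg_distrib]
    refine Finset.sum_congr rfl fun s _ => ?_
    simp only [NNReal.coe_one, sub_zero, mul_one, div_pow]
    ring

/-- The profile decreases in the norm, so a bound on the spread is a bound on the likelihood. This
and `le_prod_density` are where the likelihoods of the two models are compared with `profile`; the
posterior estimates then use only the spread. -/
theorem prod_density_le {ι : Type*} (M : Model) (S : Finset ι) (x : ι → ℝ) {m σ w : ℝ}
    (hσ : 0 < σ) (hx : SpreadGE M S x m w) :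
    ∏ s ∈ S, density M (m, σ) (x s) ≤ ENNReal.ofReal σ⁻¹ ^ S.card * profile M S.card (w / σ) := by
  cases M with
  | uniform =>
    obtain ⟨s, hs, hws⟩ := hx
    simp only [profile]
    split_ifs with hw
    · rw [mul_one, ← Finset.prod_const]
      refine Finset.prod_le_prod' fun r _ => ?_
      simp only [density, baseDensity]
      calc _ ≤ ENNReal.ofReal σ⁻¹ * 1 := by
            gcongr; exact Set.indicator_le_self _ _ _
        _ = _ := mul_one _
    · rw [mul_zero, nonpos_iff_eq_zero, Finset.prod_eq_zero hs]
      simp only [density, baseDensity]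
      rw [Set.indicator_of_notMem, mul_zero]
      rw [Set.mem_Icc, ← abs_le, abs_div, abs_of_pos hσ]
      push Not at hw ⊢
      exact hw.trans_le (by gcongr)
  | gaussian =>
    rw [prod_density_gaussian]
    simp only [profile]
    have hx' : S.card * w ^ 2 ≤ ∑ s ∈ S, (x s - m) ^ 2 := hx
    gcongr
    rw [div_pow, ← mul_div_assoc]
    gcongr

theorem le_prod_density {ι : Type*} (M : Model) (S : Finset ι) (x : ι → ℝ) {m σ w : ℝ}
    (hσ : 0 < σ) (hx : SpreadLE M S x m w) :
    ENNReal.ofReal σ⁻¹ ^ S.card * profile M S.card (w / σ) ≤ ∏ s ∈ S, density M (m, σ) (x s) := by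
  cases M with
  | uniform =>
    simp only [profile]
    split_ifs with hw
    · rw [mul_one, ← Finset.prod_const]
      refine Finset.prod_le_prod' fun r hr => ?_
      simp only [density, baseDensity]
      rw [Set.indicator_of_mem, mul_one]
      rw [Set.mem_Icc, ← abs_le, abs_div, abs_of_pos hσ]
      exact le_trans (by gcongr; exact hx r hr) hw
    · simp
  | gaussian =>
    rw [prod_density_gaussian]
    simp only [profile]
    have hx' : ∑ s ∈ S, (x s - m) ^ 2 ≤ S.card * w ^ 2 := hx
    gcongr
    rw [div_pow, ← mul_div_assoc]
    gcongr

theorem SpreadLE.near {ι : Type*} {M : Model} {S : Finset ι} {x : ι → ℝ} {m D μ : ℝ}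
    (hx : SpreadLE M S x m D) (hμ : |μ - m| ≤ D) : SpreadLE M S x μ (2 * D) := by
  cases M with
  | uniform =>
    intro s hs
    have h1 : |x s - m| ≤ D := hx s hs
    rw [abs_le] at *
    constructor <;> linarith
  | gaussian =>
    have hx' : ∑ s ∈ S, (x s - m) ^ 2 ≤ S.card * D ^ 2 := hx
    have h2 : (μ - m) ^ 2 ≤ D ^ 2 := sq_le_sq' (by linarith [(abs_le.1 hμ).1]) (abs_le.1 hμ).2
    change ∑ s ∈ S, (x s - μ) ^ 2 ≤ S.card * (2 * D) ^ 2
    calc ∑ s ∈ S, (x s - μ) ^ 2 ≤ ∑ s ∈ S, (2 * (x s - m) ^ 2 + 2 * D ^ 2) :=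
          Finset.sum_le_sum fun s _ => by nlinarith [sq_nonneg ((x s - m) + (μ - m))]
      _ = 2 * ∑ s ∈ S, (x s - m) ^ 2 + S.card * (2 * D ^ 2) := by
          rw [Finset.sum_add_distrib, Finset.mul_sum, Finset.sum_const, nsmul_eq_mul]
      _ ≤ _ := by nlinarith

/-- Reverse triangle inequality for the norm: `|μ - m| - D ≥ |μ - m| / 2`. -/
theorem SpreadLE.far {ι : Type*} {M : Model} {S : Finset ι} {x : ι → ℝ} {m D μ : ℝ}
    (hS : S.Nonempty) (hD : 0 ≤ D) (hx : SpreadLE M S x m D) (hμ : 2 * D ≤ |μ - m|) :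
    SpreadGE M S x μ (|μ - m| / 2) := by
  cases M with
  | uniform =>
    obtain ⟨s, hs⟩ := hS
    refine ⟨s, hs, ?_⟩
    have h1 : |x s - m| ≤ D := hx s hs
    have h2 : |μ - m| ≤ |x s - μ| + |x s - m| := by
      rw [abs_sub_comm (x s) μ]; exact abs_sub_le μ (x s) m
    linarith
  | gaussian =>
    have hx' : ∑ s ∈ S, (x s - m) ^ 2 ≤ S.card * D ^ 2 := hx
    have h2 : (2 * D) ^ 2 ≤ (μ - m) ^ 2 := by
      rw [← sq_abs (μ - m)]; gcongr
    change S.card * (|μ - m| / 2) ^ 2 ≤ ∑ s ∈ S, (x s - μ) ^ 2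
    have h3 : ∑ s ∈ S, ((μ - m) ^ 2 / 2 - (x s - m) ^ 2) ≤ ∑ s ∈ S, (x s - μ) ^ 2 :=
      Finset.sum_le_sum fun s _ => by nlinarith [sq_nonneg (2 * (x s - m) - (μ - m))]
    rw [Finset.sum_sub_distrib, Finset.sum_const, nsmul_eq_mul] at h3
    rw [div_pow, sq_abs]
    nlinarith [(Nat.cast_nonneg S.card : (0 : ℝ) ≤ S.card)]

/-! ### Integrating out the scale -/

/-- The integral of `σ^{-k} · σ^{-n} · profile (1 / σ)` over the scales. -/
noncomputable def profileMass (M : Model) (k : ℝ) (n : ℕ) : ℝ≥0∞ :=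
  ∫⁻ σ in Set.Ioi 0, ENNReal.ofReal (σ ^ (-k)) * (ENNReal.ofReal σ⁻¹ ^ n * profile M n (1 / σ))

/-- Homogeneity, by the substitution `σ = w v`. The spread enters only through a power, and the
remaining factor `profileMass` cancels when the posterior is normalized. -/
theorem lintegral_profile (M : Model) (k : ℝ) (n : ℕ) {w : ℝ} (hw : 0 < w) :
    ∫⁻ σ in Set.Ioi 0, ENNReal.ofReal (σ ^ (-k)) *
        (ENNReal.ofReal σ⁻¹ ^ n * profile M n (w / σ)) =
      ENNReal.ofReal (w ^ (1 - k - n)) * profileMass M k n := by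
  have hp := measurable_profile M n
  rw [setLIntegral_Ioi_comp_mul_left _ (by fun_prop) hw, profileMass]
  rw [← lintegral_const_mul' _ _ ENNReal.ofReal_ne_top,
    ← lintegral_const_mul' _ _ ENNReal.ofReal_ne_top]
  refine setLIntegral_congr_fun measurableSet_Ioi fun v hv => ?_
  have hv' : 0 < v := hv
  have e : w / (w * v) = 1 / v := by field_simp
  simp only [e]
  rw [← mul_assoc, ← mul_assoc, ← mul_assoc, ← mul_assoc]
  congr 1
  rw [← ENNReal.ofReal_pow (by positivity), ← ENNReal.ofReal_pow (by positivity),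
    ← ENNReal.ofReal_mul (by positivity), ← ENNReal.ofReal_mul (by positivity),
    ← ENNReal.ofReal_mul (by positivity), ← ENNReal.ofReal_mul (by positivity)]
  congr 1
  rw [Real.mul_rpow hw.le hv'.le, Real.rpow_sub hw, Real.rpow_sub hw, Real.rpow_one,
    Real.rpow_natCast, Real.rpow_neg hw.le, mul_inv, mul_pow, inv_pow w]
  field_simp

theorem profileMass_ne_zero (M : Model) (k : ℝ) (n : ℕ) : profileMass M k n ≠ 0 := by
  have hp := measurable_profile M n
  rw [← pos_iff_ne_zero, profileMass, setLIntegral_pos_iff (by fun_prop)]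
  refine lt_of_lt_of_le ?_ (measure_mono (s := Set.Icc (2 : ℝ) 3) fun v hv => ⟨?_, ?_⟩)
  · rw [Real.volume_Icc]; norm_num
  · have hv0 : 0 < v := by linarith [hv.1]
    refine mul_ne_zero ?_ (mul_ne_zero (pow_ne_zero _ ?_) (profile_ne_zero M n ?_))
    · rw [← pos_iff_ne_zero, ENNReal.ofReal_pos]; positivity
    · rw [← pos_iff_ne_zero, ENNReal.ofReal_pos]; positivity
    · rw [div_le_div_iff₀ hv0 (by norm_num)]; linarith [hv.1]
  · exact lt_of_lt_of_le (by norm_num) hv.1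

theorem exists_rpow_mul_profile_le (M : Model) (p : ℝ) {n : ℕ} (hn : 1 ≤ n) :
    ∃ B : ℝ, 1 ≤ B ∧ ∀ w : ℝ, 1 ≤ w →
      ENNReal.ofReal (w ^ p) * profile M n w ≤ ENNReal.ofReal B := by
  cases M with
  | uniform =>
    refine ⟨1, le_rfl, fun w hw => ?_⟩
    have : ¬ w ≤ 1 / 2 := by linarith
    simp only [profile, if_neg this, mul_zero]
    exact zero_le
  | gaussian =>
    set m := ⌈p⌉₊
    refine ⟨2 ^ m * m.factorial, ?_, fun w hw => ?_⟩
    · exact_mod_cast Nat.one_le_iff_ne_zero.2 (by positivity)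
    have hw0 : 0 < w := by linarith
    simp only [profile]
    rw [← ENNReal.ofReal_mul (by positivity)]
    apply ENNReal.ofReal_le_ofReal
    have h1 : w ^ p ≤ (w ^ 2) ^ m := by
      calc w ^ p ≤ w ^ (m : ℝ) := Real.rpow_le_rpow_of_exponent_le hw (Nat.le_ceil p)
        _ = w ^ m := Real.rpow_natCast _ _
        _ ≤ (w ^ 2) ^ m := by gcongr; nlinarith
    have h2 := Real.pow_div_factorial_le_exp (x := w ^ 2 / 2) (by positivity) m
    have h3 : Real.exp (-(n * w ^ 2 / 2)) ≤ (Real.exp (w ^ 2 / 2))⁻¹ := by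
      rw [← Real.exp_neg]
      have : (1 : ℝ) ≤ n := by exact_mod_cast hn
      gcongr
      nlinarith [sq_nonneg w]
    have h4 : (w ^ 2) ^ m ≤ 2 ^ m * m.factorial * Real.exp (w ^ 2 / 2) := by
      rw [div_pow, div_div, div_le_iff₀ (by positivity)] at h2
      linarith
    calc w ^ p * ((√(2 * Real.pi))⁻¹ ^ n * Real.exp (-(n * w ^ 2 / 2)))
        ≤ (w ^ 2) ^ m * (1 * (Real.exp (w ^ 2 / 2))⁻¹) := by
          gcongr
          exact pow_le_one₀ (by positivity) inv_sqrt_two_pi_le_one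
      _ ≤ 2 ^ m * m.factorial * Real.exp (w ^ 2 / 2) * (1 * (Real.exp (w ^ 2 / 2))⁻¹) := by
          gcongr
      _ = _ := by field_simp

theorem lintegral_inv_one_add_sq :
    ∫⁻ x : ℝ, ENNReal.ofReal (1 + x ^ 2)⁻¹ = ENNReal.ofReal Real.pi := by
  rw [← ofReal_integral_eq_lintegral_ofReal integrable_inv_one_add_sq
    (Eventually.of_forall fun x => by positivity), integral_univ_inv_one_add_sq]

/-- Small scales are controlled by the decay of the profile, large ones by `v^{-(k + n)}` with `k +
n ≥ 2`. Both are dominated by a multiple of the Cauchy density. -/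
theorem profileMass_ne_top (M : Model) {k : ℝ} (hk : 1 ≤ k) {n : ℕ} (hn : 1 ≤ n) :
    profileMass M k n ≠ ∞ := by
  obtain ⟨B, hB1, hB⟩ := exists_rpow_mul_profile_le M (k + n) hn
  have hn' : (1 : ℝ) ≤ n := by exact_mod_cast hn
  have key : ∀ v ∈ Set.Ioi (0 : ℝ), ENNReal.ofReal (v ^ (-k)) *
      (ENNReal.ofReal v⁻¹ ^ n * profile M n (1 / v)) ≤
      ENNReal.ofReal (2 * B) * ENNReal.ofReal (1 + v ^ 2)⁻¹ := by
    intro v hv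
    have hv0 : 0 < v := hv
    have e : ENNReal.ofReal (v ^ (-k)) * ENNReal.ofReal v⁻¹ ^ n =
        ENNReal.ofReal ((1 / v) ^ (k + n)) := by
      rw [← ENNReal.ofReal_pow (by positivity), ← ENNReal.ofReal_mul (by positivity)]
      congr 1
      rw [Real.rpow_add (by positivity), Real.rpow_natCast, one_div, Real.inv_rpow hv0.le,
        Real.rpow_neg hv0.le]
    rw [← mul_assoc, e, ← ENNReal.ofReal_mul (by positivity)]
    rcases le_or_gt v 1 with h1 | h1
    · refine (hB (1 / v) (by rw [le_div_iff₀ hv0]; linarith)).trans ?_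
      apply ENNReal.ofReal_le_ofReal
      rw [← div_eq_mul_inv, le_div_iff₀ (by positivity)]
      have : v ^ 2 ≤ 1 := pow_le_one₀ hv0.le h1
      nlinarith
    · calc _ ≤ ENNReal.ofReal ((1 / v) ^ (k + n)) * 1 := by gcongr; exact profile_le_one _ _ _
        _ = ENNReal.ofReal ((1 / v) ^ (k + n)) := mul_one _
        _ ≤ _ := by
          apply ENNReal.ofReal_le_ofReal
          calc (1 / v) ^ (k + n) ≤ (1 / v) ^ (2 : ℝ) :=
                Real.rpow_le_rpow_of_exponent_ge (by positivity)
                  (by rw [div_le_one hv0]; exact h1.le) (by linarith)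
            _ = (1 / v) ^ 2 := Real.rpow_two _
            _ ≤ 2 * B * (1 + v ^ 2)⁻¹ := by
              rw [← div_eq_mul_inv, div_pow, div_le_div_iff₀ (by positivity) (by positivity)]
              nlinarith
  have := calc profileMass M k n
      ≤ ∫⁻ v in Set.Ioi 0, ENNReal.ofReal (2 * B) * ENNReal.ofReal (1 + v ^ 2)⁻¹ :=
        setLIntegral_mono' measurableSet_Ioi key
    _ ≤ ∫⁻ v, ENNReal.ofReal (2 * B) * ENNReal.ofReal (1 + v ^ 2)⁻¹ := setLIntegral_le_lintegral _ _
    _ = ENNReal.ofReal (2 * B) * ENNReal.ofReal Real.pi := by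
        rw [lintegral_const_mul' _ _ ENNReal.ofReal_ne_top, lintegral_inv_one_add_sq]
    _ < ∞ := ENNReal.mul_lt_top ENNReal.ofReal_lt_top ENNReal.ofReal_lt_top
  exact this.ne

/-! ### Posterior concentration -/

/-- The prior has density `κ σ^{-k}` with respect to Lebesgue measure on `ℝ × ℝ₊`. -/
def HasPowerDensity (prior : Measure (ℝ × ℝ)) (κ : ℝ≥0∞) (k : ℝ) : Prop :=
  ∀ φ : ℝ × ℝ → ℝ≥0∞, Measurable φ →
    ∫⁻ θ, φ θ ∂prior = κ * ∫⁻ μ, ∫⁻ σ in Set.Ioi 0, ENNReal.ofReal (σ ^ (-k)) * φ (μ, σ)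

/-- The rounds at which arm `i` was played. -/
def armRounds {K t : ℕ} (i : Fin K) (H : Hist K t) : Finset (Fin t) :=
  Finset.univ.filter fun s => (H s).1 = i

theorem likelihood_eq_prod (M : Model) {K t : ℕ} (i : Fin K) (H : Hist K t) (θ : ℝ × ℝ) :
    likelihood M i H θ = ∏ s ∈ armRounds i H, density M θ (H s).2 := by
  rw [likelihood, armRounds, Finset.prod_filter]

theorem measurable_likelihood_right (M : Model) {K t : ℕ} (i : Fin K) (H : Hist K t) :
    Measurable (likelihood M i H) :=
  (measurable_likelihood M i).comp measurable_prodMk_left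

/-- The density of the location parameter under `likelihood · σ^{-k}`. -/
noncomputable def marginal (M : Model) (k : ℝ) {K t : ℕ} (i : Fin K) (H : Hist K t) (μ : ℝ) :
    ℝ≥0∞ :=
  ∫⁻ σ in Set.Ioi 0, ENNReal.ofReal (σ ^ (-k)) * likelihood M i H (μ, σ)

theorem evidence_eq {M : Model} {prior : Measure (ℝ × ℝ)} {κ : ℝ≥0∞} {k : ℝ}
    (hp : HasPowerDensity prior κ k) {K t : ℕ} (i : Fin K) (H : Hist K t) :
    evidence M prior i H = κ * ∫⁻ μ, marginal M k i H μ :=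
  hp _ (measurable_likelihood_right M i H)

theorem setLIntegral_likelihood {M : Model} {prior : Measure (ℝ × ℝ)} {κ : ℝ≥0∞} {k : ℝ}
    (hp : HasPowerDensity prior κ k) {K t : ℕ} (i : Fin K) (H : Hist K t) {A : Set ℝ}
    (hA : MeasurableSet A) :
    ∫⁻ θ in Prod.fst ⁻¹' A, likelihood M i H θ ∂prior = κ * ∫⁻ μ in A, marginal M k i H μ := by
  have hA' : MeasurableSet (Prod.fst ⁻¹' A : Set (ℝ × ℝ)) := measurable_fst hA
  rw [← lintegral_indicator hA', hp _ ((measurable_likelihood_right M i H).indicator hA'),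
    ← lintegral_indicator hA]
  congr 2 with μ
  by_cases hμ : μ ∈ A
  · rw [Set.indicator_of_mem hμ, marginal]
    refine lintegral_congr fun σ => ?_
    rw [Set.indicator_of_mem (by exact hμ)]
  · rw [Set.indicator_of_notMem hμ]
    have : ∀ σ, (Prod.fst ⁻¹' A).indicator (likelihood M i H) (μ, σ) = 0 :=
      fun σ => Set.indicator_of_notMem (by exact hμ) _
    simp [this]

theorem marginal_le (M : Model) (k : ℝ) {K t : ℕ} (i : Fin K) (H : Hist K t) {μ w : ℝ}
    (hw : 0 < w) (hx : SpreadGE M (armRounds i H) (fun s => (H s).2) μ w) :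
    marginal M k i H μ ≤ ENNReal.ofReal (w ^ (1 - k - (armRounds i H).card)) *
      profileMass M k (armRounds i H).card := by
  rw [← lintegral_profile M k _ hw]
  refine setLIntegral_mono' measurableSet_Ioi fun σ hσ => ?_
  rw [likelihood_eq_prod]
  gcongr
  exact prod_density_le M _ _ hσ hx

theorem le_marginal (M : Model) (k : ℝ) {K t : ℕ} (i : Fin K) (H : Hist K t) {μ w : ℝ}
    (hw : 0 < w) (hx : SpreadLE M (armRounds i H) (fun s => (H s).2) μ w) :
    ENNReal.ofReal (w ^ (1 - k - (armRounds i H).card)) *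
      profileMass M k (armRounds i H).card ≤ marginal M k i H μ := by
  rw [← lintegral_profile M k _ hw]
  refine setLIntegral_mono' measurableSet_Ioi fun σ hσ => ?_
  rw [likelihood_eq_prod]
  gcongr
  exact le_prod_density M _ _ hσ hx

/-- At distance `u ≥ 1/2` from `m` the sample has norm at least `u / 2`, so the marginal decays like
`u^{1 - k - n}`, which is integrable at infinity. -/
theorem setLIntegral_marginal_far_le (M : Model) {k : ℝ} (hk : 1 ≤ k) {K t : ℕ} (i : Fin K)
    (H : Hist K t) (hn : 2 ≤ (armRounds i H).card) {m D : ℝ} (hD : 0 < D) (hD1 : 8 * D ≤ 1)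
    (hx : SpreadLE M (armRounds i H) (fun s => (H s).2) m D) :
    ∫⁻ μ in {μ | 1 / 2 ≤ |μ - m|}, marginal M k i H μ ≤
      ENNReal.ofReal (4 ^ (k + (armRounds i H).card)) *
        profileMass M k (armRounds i H).card := by
  set n := (armRounds i H).card with hndef
  have hne : (armRounds i H).Nonempty := Finset.card_pos.1 (by omega)
  have hn' : (2 : ℝ) ≤ n := by exact_mod_cast hn
  have hset : MeasurableSet {μ : ℝ | 1 / 2 ≤ |μ - m|} :=
    measurableSet_le measurable_const (by fun_prop)
  set P := profileMass M k n
  have key : ∀ μ ∈ {μ : ℝ | 1 / 2 ≤ |μ - m|}, marginal M k i H μ ≤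
      ENNReal.ofReal (4 ^ (k + n - 3) * 20) * P * ENNReal.ofReal (1 + (μ - m) ^ 2)⁻¹ := by
    intro μ hμ
    have hu : 1 / 2 ≤ |μ - m| := hμ
    set u := |μ - m|
    refine (marginal_le M k i H (w := u / 2) (by linarith)
      (hx.far hne hD.le (by linarith))).trans ?_
    rw [← hndef, mul_right_comm, ← ENNReal.ofReal_mul (by positivity)]
    gcongr
    rw [← sq_abs (μ - m)]
    change (u / 2) ^ (1 - k - n) ≤ 4 ^ (k + n - 3) * 20 * (1 + u ^ 2)⁻¹
    -- The exponent `3 - k - n` is nonpositive, so the first factor is largest at `u = 1/2`; the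
    -- second is compared with the Cauchy density, with equality for the constant `20` at `u = 1/2`.
    have e : (u / 2) ^ (1 - k - n) = (u / 2) ^ (3 - k - n) * ((u / 2) ^ 2)⁻¹ := by
      rw [← Real.rpow_two, ← Real.rpow_neg (by linarith), ← Real.rpow_add (by linarith)]
      ring_nf
    have h1 : (u / 2) ^ (3 - k - n) ≤ 4 ^ (k + n - 3) := by
      calc (u / 2) ^ (3 - k - n) ≤ (1 / 4) ^ (3 - k - n) :=
            Real.rpow_le_rpow_of_nonpos (by norm_num) (by linarith) (by linarith)
        _ = 4 ^ (k + n - 3) := by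
            rw [one_div, Real.inv_rpow (by norm_num), ← Real.rpow_neg (by norm_num)]
            ring_nf
    have h2 : ((u / 2) ^ 2)⁻¹ ≤ 20 * (1 + u ^ 2)⁻¹ := by
      rw [← div_eq_mul_inv, ← one_div, div_le_div_iff₀ (by positivity) (by positivity)]
      nlinarith
    rw [e, mul_assoc]
    gcongr
  calc _ ≤ ∫⁻ μ in {μ : ℝ | 1 / 2 ≤ |μ - m|}, ENNReal.ofReal (4 ^ (k + n - 3) * 20) * P *
        ENNReal.ofReal (1 + (μ - m) ^ 2)⁻¹ := setLIntegral_mono' hset key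
    _ ≤ ∫⁻ μ, ENNReal.ofReal (4 ^ (k + n - 3) * 20) * P *
        ENNReal.ofReal (1 + (μ - m) ^ 2)⁻¹ := setLIntegral_le_lintegral _ _
    _ = ENNReal.ofReal (4 ^ (k + n - 3) * 20) * P * ENNReal.ofReal Real.pi := by
        rw [lintegral_const_mul _ (by fun_prop),
          lintegral_sub_right_eq_self (fun μ => ENNReal.ofReal (1 + μ ^ 2)⁻¹) m,
          lintegral_inv_one_add_sq]
    _ = ENNReal.ofReal (4 ^ (k + n - 3) * 20 * Real.pi) * P := by
        rw [mul_right_comm, ← ENNReal.ofReal_mul (by positivity)]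
    _ ≤ _ := by
        gcongr
        -- The constant closes because `20 π ≤ 64`.
        have : (4 : ℝ) ^ (k + n) = 4 ^ (k + n - 3) * 64 := by
          rw [Real.rpow_sub (by norm_num)]; norm_num
        rw [this, mul_assoc]
        gcongr
        linarith [Real.pi_lt_d2]

/-- Locations within `D` of `m` see a spread of at most `2D`, and they form an interval of length
`2D`. -/
theorem le_lintegral_marginal (M : Model) (k : ℝ) {K t : ℕ} (i : Fin K)
    (H : Hist K t) {m D : ℝ} (hD : 0 < D)
    (hx : SpreadLE M (armRounds i H) (fun s => (H s).2) m D) :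
    ENNReal.ofReal ((2 * D) ^ (2 - k - (armRounds i H).card)) *
        profileMass M k (armRounds i H).card ≤ ∫⁻ μ, marginal M k i H μ := by
  set n := (armRounds i H).card with hndef
  set P := profileMass M k n
  calc _ = ENNReal.ofReal ((2 * D) ^ (1 - k - n)) * P * ENNReal.ofReal (2 * D) := by
        rw [mul_right_comm, ← ENNReal.ofReal_mul (by positivity)]
        congr 2
        conv_rhs => rw [← Real.rpow_add_one (by positivity)]
        congr 1; ring
    _ = ∫⁻ μ in Set.Icc (m - D) (m + D), ENNReal.ofReal ((2 * D) ^ (1 - k - n)) * P := by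
        rw [setLIntegral_const, Real.volume_Icc]; congr 2; ring
    _ ≤ ∫⁻ μ in Set.Icc (m - D) (m + D), marginal M k i H μ := by
        refine setLIntegral_mono' measurableSet_Icc fun μ hμ => ?_
        refine le_marginal M k i H (by positivity) (hx.near ?_)
        rw [abs_le]; constructor <;> linarith [hμ.1, hμ.2]
    _ ≤ _ := setLIntegral_le_lintegral _ _

/-- The quotient of the two preceding bounds is `16 (8D)^{k + n - 2}`. Since `k ≥ 1`, two
observations already give a bound linear in `D`, while many observations give exponential decay. -/
theorem posterior_far_le {M : Model} {prior : Measure (ℝ × ℝ)} {κ : ℝ≥0∞} {k : ℝ}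
    (hp : HasPowerDensity prior κ k) (hk : 1 ≤ k) {K t : ℕ} (i : Fin K)
    (H : Hist K t) (hn : 2 ≤ (armRounds i H).card) {m D : ℝ} (hD : 0 < D) (hD1 : 8 * D ≤ 1)
    (hx : SpreadLE M (armRounds i H) (fun s => (H s).2) m D)
    (hE0 : evidence M prior i H ≠ 0) (hEt : evidence M prior i H ≠ ∞) :
    posterior M prior i H {θ | 1 / 2 ≤ |θ.1 - m|} ≤
      ENNReal.ofReal (16 * (8 * D) ^ ((armRounds i H).card - 1)) := by
  have hset : MeasurableSet {μ : ℝ | 1 / 2 ≤ |μ - m|} :=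
    measurableSet_le measurable_const (by fun_prop)
  have hpre : {θ : ℝ × ℝ | 1 / 2 ≤ |θ.1 - m|} = Prod.fst ⁻¹' {μ : ℝ | 1 / 2 ≤ |μ - m|} := rfl
  have hnot : ¬ (evidence M prior i H = 0 ∨ evidence M prior i H = ∞) := by tauto
  rw [posterior, if_neg hnot, hpre, Measure.smul_apply, smul_eq_mul,
    withDensity_apply _ (measurable_fst hset), setLIntegral_likelihood hp i H hset,
    ENNReal.inv_mul_le_iff hE0 hEt, evidence_eq hp, mul_assoc]
  gcongr
  refine (setLIntegral_marginal_far_le M hk i H hn hD hD1 hx).trans ?_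
  refine le_trans ?_ (mul_le_mul_left (le_lintegral_marginal M k i H hD hx) _)
  set n := (armRounds i H).card
  rw [mul_right_comm, ← ENNReal.ofReal_mul (by positivity)]
  gcongr
  have h1 : (8 * D) ^ (k + n - 2) ≤ (8 * D) ^ (n - 1) := by
    rw [← Real.rpow_natCast (8 * D) (n - 1)]
    apply Real.rpow_le_rpow_of_exponent_ge (by positivity) hD1
    rw [Nat.cast_sub (by omega)]
    push_cast; linarith
  calc (4 : ℝ) ^ (k + n) = (2 * D) ^ (2 - k - n) * (16 * (8 * D) ^ (k + n - 2)) := by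
        have h2 : (4 : ℝ) ^ (k + n) = 4 ^ (k + n - 2) * 16 := by
          rw [Real.rpow_sub (by norm_num)]; norm_num
        have h3 : (2 * D) ^ (2 - k - n) * (2 * D) ^ (k + n - 2) = 1 := by
          rw [← Real.rpow_add (by positivity), show 2 - k - (n : ℝ) + (k + n - 2) = 0 by ring,
            Real.rpow_zero]
        have h4 : (8 * D) ^ (k + n - 2) = 4 ^ (k + n - 2) * (2 * D) ^ (k + n - 2) := by
          rw [← Real.mul_rpow (by norm_num) (by positivity)]; ring_nf
        rw [h2, h4]
        linear_combination (-(4 : ℝ) ^ (k + n - 2) * 16) * h3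
    _ ≤ _ := by gcongr

theorem evidence_ne_zero {M : Model} {prior : Measure (ℝ × ℝ)} {κ : ℝ≥0∞} {k : ℝ}
    (hp : HasPowerDensity prior κ k) (hκ : κ ≠ 0) {K t : ℕ} (i : Fin K)
    (H : Hist K t) {m D : ℝ} (hD : 0 < D)
    (hx : SpreadLE M (armRounds i H) (fun s => (H s).2) m D) :
    evidence M prior i H ≠ 0 := by
  rw [evidence_eq hp]
  refine mul_ne_zero hκ (ne_of_gt (lt_of_lt_of_le ?_ (le_lintegral_marginal M k i H hD hx)))
  rw [pos_iff_ne_zero]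
  refine mul_ne_zero ?_ (profileMass_ne_zero _ _ _)
  rw [← pos_iff_ne_zero, ENNReal.ofReal_pos]; positivity

/-- The far part is finite by the tail bound. Near `m` the marginal is bounded because the rewards
are not all equal: their spread is at least `w` around every location. -/
theorem evidence_ne_top {M : Model} {prior : Measure (ℝ × ℝ)} {κ : ℝ≥0∞} {k : ℝ}
    (hp : HasPowerDensity prior κ k) (hκ : κ ≠ ∞) (hk : 1 ≤ k) {K t : ℕ} (i : Fin K)
    (H : Hist K t) (hn : 2 ≤ (armRounds i H).card) {m D : ℝ} (hD : 0 < D) (hD1 : 8 * D ≤ 1)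
    (hx : SpreadLE M (armRounds i H) (fun s => (H s).2) m D) {w : ℝ} (hw : 0 < w)
    (hx' : ∀ μ, SpreadGE M (armRounds i H) (fun s => (H s).2) μ w) :
    evidence M prior i H ≠ ∞ := by
  rw [evidence_eq hp]
  refine ENNReal.mul_ne_top hκ ?_
  have hP := profileMass_ne_top M hk (n := (armRounds i H).card) (by omega)
  have hset : MeasurableSet {μ : ℝ | 1 / 2 ≤ |μ - m|} :=
    measurableSet_le measurable_const (by fun_prop)
  rw [← lintegral_add_compl _ hset]
  refine ENNReal.add_ne_top.2 ⟨ne_top_of_le_ne_top (ENNReal.mul_ne_top ENNReal.ofReal_ne_top hP)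
    (setLIntegral_marginal_far_le M hk i H hn hD hD1 hx), ?_⟩
  refine ne_top_of_le_ne_top ?_ (setLIntegral_mono' hset.compl
    fun μ _ => marginal_le M k i H hw (hx' μ))
  rw [setLIntegral_const]
  refine ENNReal.mul_ne_top (ENNReal.mul_ne_top ENNReal.ofReal_ne_top hP) ?_
  refine ne_top_of_le_ne_top (b := volume (Set.Icc (m - 1) (m + 1))) (by simp) (measure_mono ?_)
  intro μ hμ
  simp only [Set.mem_compl_iff, Set.mem_ofPred_eq, not_le] at hμ
  rw [abs_lt] at hμ
  constructor <;> linarith [hμ.1, hμ.2]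

/-- Around `0`, nondegeneracy of the evidence need not be assumed. (The evidence is only degenerate
when all the rewards of the arm coincide, which has probability zero; the posterior is then
conventionally located at `0`, and the bound is trivial.) -/
theorem posterior_far_zero_le {M : Model} {prior : Measure (ℝ × ℝ)} {κ : ℝ≥0∞} {k : ℝ}
    (hp : HasPowerDensity prior κ k) (hk : 1 ≤ k) {K t : ℕ} (i : Fin K)
    (H : Hist K t) (hn : 2 ≤ (armRounds i H).card) {D : ℝ} (hD : 0 < D) (hD1 : 8 * D ≤ 1)
    (hx : SpreadLE M (armRounds i H) (fun s => (H s).2) 0 D) :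
    posterior M prior i H {θ | 1 / 2 ≤ |θ.1|} ≤
      ENNReal.ofReal (16 * (8 * D) ^ ((armRounds i H).card - 1)) := by
  by_cases hE : evidence M prior i H = 0 ∨ evidence M prior i H = ∞
  · have hset : MeasurableSet {θ : ℝ × ℝ | 1 / 2 ≤ |θ.1|} :=
      measurableSet_le measurable_const (by fun_prop)
    rw [posterior, if_pos hE, Measure.dirac_apply' _ hset, Set.indicator_of_notMem]
    · exact zero_le
    · norm_num
  · push Not at hE
    simpa using posterior_far_le hp hk i H hn hD hD1 hx hE.1 hE.2

/-! ### The interaction -/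

theorem measurable_hist_snoc {K t : ℕ} :
    Measurable (fun p : Hist K t × Fin K × ℝ => (Fin.snoc p.1 p.2 : Hist K (t + 1))) := by
  refine measurable_pi_lambda _ fun s => ?_
  induction s using Fin.lastCases with
  | last => simp only [Fin.snoc_last]; exact measurable_snd
  | cast s => simp only [Fin.snoc_castSucc]; exact (measurable_pi_apply s).comp measurable_fst

theorem isMarkovKernel_rewardKernel (M : Model) {K : ℕ} {θ : Fin K → ℝ × ℝ}
    (hθ : ∀ i, θ i ∈ paramSpace) (t : ℕ) : IsMarkovKernel (rewardKernel M θ t) :=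
  ⟨fun p => isProbabilityMeasure_rewardLaw M (hθ p.2)⟩

theorem isProbabilityMeasure_histLaw (M : Model) {K : ℕ} (π : Policy K) {θ : Fin K → ℝ × ℝ}
    (hθ : ∀ i, θ i ∈ paramSpace) (t : ℕ) : IsProbabilityMeasure (histLaw M π θ t) := by
  induction t with
  | zero => unfold histLaw; infer_instance
  | succ t ih =>
    have := isMarkovKernel_rewardKernel M hθ t
    have := π.markov t
    unfold histLaw
    refine Measure.isProbabilityMeasure_map ?_
    exact (measurable_hist_snoc.comp (f := fun p : (Hist K t × Fin K) × ℝ =>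
      (p.1.1, (p.1.2, p.2))) (by fun_prop)).aemeasurable

theorem lintegral_histLaw_succ (M : Model) {K : ℕ} (π : Policy K) {θ : Fin K → ℝ × ℝ}
    (hθ : ∀ i, θ i ∈ paramSpace) (t : ℕ) (f : Hist K (t + 1) → ℝ≥0∞) (hf : Measurable f) :
    ∫⁻ H, f H ∂(histLaw M π θ (t + 1)) =
      ∫⁻ H, ∑ a, (∫⁻ x, f (Fin.snoc H (a, x)) ∂(rewardLaw M (θ a))) * π.play t H {a}
        ∂(histLaw M π θ t) := by
  have := isMarkovKernel_rewardKernel M hθ t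
  have := π.markov t
  have := isProbabilityMeasure_histLaw M π hθ t
  have hm : Measurable (fun p : (Hist K t × Fin K) × ℝ =>
      (Fin.snoc p.1.1 (p.1.2, p.2) : Hist K (t + 1))) :=
    measurable_hist_snoc.comp (f := fun p : (Hist K t × Fin K) × ℝ =>
      (p.1.1, (p.1.2, p.2))) (by fun_prop)
  have hfm : Measurable (fun p : (Hist K t × Fin K) × ℝ =>
      f (Fin.snoc p.1.1 (p.1.2, p.2))) := hf.comp hm
  rw [histLaw, lintegral_map hf hm, Measure.lintegral_compProd hfm,
    Measure.lintegral_compProd]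
  · simp only [lintegral_fintype]
    rfl
  · exact hfm.lintegral_kernel_prod_right'

theorem expectedRegret_succ (M : Model) {K : ℕ} (π : Policy K) {θ : Fin K → ℝ × ℝ}
    (hθ : ∀ i, θ i ∈ paramSpace) (iStar : Fin K) (T : ℕ) :
    expectedRegret M π θ iStar (T + 1) = expectedRegret M π θ iStar T +
      ∫⁻ H, ENNReal.ofReal ((θ iStar).1 - (θ (H (Fin.last T)).1).1)
        ∂(histLaw M π θ (T + 1)) := by
  have hθm : Measurable θ := measurable_of_countable θ
  have := π.markov T
  have hprob := fun a => isProbabilityMeasure_rewardLaw M (hθ a)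
  simp only [expectedRegret, Fin.sum_univ_castSucc]
  rw [lintegral_add_left (by fun_prop)]
  congr 1
  rw [lintegral_histLaw_succ M π hθ T _ (by fun_prop)]
  refine lintegral_congr fun H => ?_
  simp only [Fin.snoc_castSucc, lintegral_const, measure_univ, mul_one]
  rw [← Finset.mul_sum, sum_measure_singleton]
  simp

/-! ### Starving the optimal arm -/

/-- The arm played at round `s` when arm `1` is always played after the initial plays. -/
def starvingArm (s : ℕ) : Fin 2 := if s = 0 ∨ s = 2 then 0 else 1

/-- The histories in which arm `0` is only played initially, with two rewards at distance at most
`δ` from each other, the first of which lies in `[-2, -3/2]`. -/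
def starvingHist (δ : ℝ) (t : ℕ) : Set (Hist 2 t) :=
  {H | (∀ s : Fin t, (H s).1 = starvingArm s) ∧
    (∀ s : Fin t, (s : ℕ) = 0 → (H s).2 ∈ Set.Icc (-2 : ℝ) (-(3 / 2))) ∧
    ∀ r s : Fin t, (r : ℕ) = 0 → (s : ℕ) = 2 → (H s).2 ∈ Set.Ioc (H r).2 ((H r).2 + δ)}

theorem measurableSet_starvingHist (δ : ℝ) (t : ℕ) : MeasurableSet (starvingHist δ t) := by
  refine MeasurableSet.inter ?_ (MeasurableSet.inter ?_ ?_)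
  · refine measurableSet_setOfPred.2 (Measurable.forall fun s => measurableSet_setOfPred.1 ?_)
    exact measurableSet_eq_fun (by fun_prop) measurable_const
  · refine measurableSet_setOfPred.2 (Measurable.forall fun s => Measurable.imp measurable_const ?_)
    exact measurableSet_setOfPred.1 (measurableSet_Icc.preimage (by fun_prop))
  · refine measurableSet_setOfPred.2 (Measurable.forall fun r => Measurable.forall fun s =>
      Measurable.imp measurable_const (Measurable.imp measurable_const ?_))
    exact measurableSet_setOfPred.1 ((measurableSet_lt (f := fun H : Hist 2 t => (H r).2)
      (g := fun H => (H s).2) (by fun_prop) (by fun_prop)).inter (measurableSet_le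
      (f := fun H : Hist 2 t => (H s).2) (g := fun H => (H r).2 + δ)
      (by fun_prop) (by fun_prop)))

theorem snoc_mem_starvingHist {δ : ℝ} {t : ℕ} (ht : 3 ≤ t) (H : Hist 2 t) (a : Fin 2) (x : ℝ) :
    (Fin.snoc H (a, x) : Hist 2 (t + 1)) ∈ starvingHist δ (t + 1) ↔
      H ∈ starvingHist δ t ∧ a = 1 := by
  have h0 : t ≠ 0 := by omega
  have h2 : t ≠ 2 := by omega
  simp only [starvingHist, Set.mem_ofPred_eq, Fin.forall_fin_succ', Fin.snoc_castSucc,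
    Fin.snoc_last, Fin.val_castSucc, Fin.val_last, starvingArm, h0, h2]
  simp
  tauto

theorem three_mem_starvingHist {δ x y z : ℝ} :
    (![(0, x), (1, y), (0, z)] : Hist 2 3) ∈ starvingHist δ 3 ↔
      x ∈ Set.Icc (-2 : ℝ) (-(3 / 2)) ∧ z ∈ Set.Ioc x (x + δ) := by
  simp [starvingHist, Fin.forall_fin_succ, starvingArm]

/-- The product of the weights `ψ` of the rewards of arm `1`. -/
noncomputable def rewardWeight (ψ : ℝ → ℝ≥0∞) {t : ℕ} (H : Hist 2 t) : ℝ≥0∞ :=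
  ∏ s, if (H s).1 = 1 then ψ (H s).2 else 1

theorem measurable_rewardWeight {ψ : ℝ → ℝ≥0∞} (hψ : Measurable ψ) (t : ℕ) :
    Measurable (rewardWeight ψ : Hist 2 t → ℝ≥0∞) := by
  unfold rewardWeight
  refine Finset.measurable_prod _ fun s _ => Measurable.ite ?_ ?_ measurable_const
  · exact measurableSet_eq_fun (by fun_prop) measurable_const
  · exact hψ.comp (by fun_prop)

theorem rewardWeight_snoc (ψ : ℝ → ℝ≥0∞) {t : ℕ} (H : Hist 2 t) (x : ℝ) :
    rewardWeight ψ (Fin.snoc H (1, x) : Hist 2 (t + 1)) = rewardWeight ψ H * ψ x := by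
  simp only [rewardWeight, Fin.prod_univ_castSucc, Fin.snoc_castSucc, Fin.snoc_last]
  simp

theorem rewardWeight_eq_prod (ψ : ℝ → ℝ≥0∞) {t : ℕ} (H : Hist 2 t) :
    rewardWeight ψ H = ∏ s ∈ armRounds 1 H, ψ (H s).2 := by
  rw [rewardWeight, armRounds, Finset.prod_filter]

theorem rewardWeight_one {t : ℕ} (H : Hist 2 t) : rewardWeight (fun _ => 1) H = 1 := by
  simp [rewardWeight]

/-- The probability of the initial rewards of arm `0` in `starvingHist`. -/
noncomputable def starvingMass (ν : Measure ℝ) (δ : ℝ) : ℝ≥0∞ :=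
  ∫⁻ x, (Set.Icc (-2 : ℝ) (-(3 / 2))).indicator (fun x => ν (Set.Ioc x (x + δ))) x ∂ν

/-- On the event only the branch playing arm `1` survives, and its new reward is independent of the
past. The weight `ψ = 1` yields probabilities; an exponential weight controls the samples of arm `1`
jointly with the event. -/
theorem lintegral_starving_succ (M : Model) (π : Policy 2) {θ : Fin 2 → ℝ × ℝ}
    (hθ : ∀ i, θ i ∈ paramSpace) {δ : ℝ} {ψ : ℝ → ℝ≥0∞} (hψ : Measurable ψ) {t : ℕ}
    (ht : 3 ≤ t) :
    ∫⁻ H in starvingHist δ (t + 1), rewardWeight ψ H ∂(histLaw M π θ (t + 1)) =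
      (∫⁻ H in starvingHist δ t, rewardWeight ψ H * π.play t H {1} ∂(histLaw M π θ t)) *
        ∫⁻ x, ψ x ∂(rewardLaw M (θ 1)) := by
  have hE := measurableSet_starvingHist δ
  have hW := measurable_rewardWeight hψ
  have hplay : Measurable fun H => π.play t H {1} :=
    Kernel.measurable_coe _ (measurableSet_singleton 1)
  have hWp : Measurable fun H : Hist 2 t => rewardWeight ψ H * π.play t H {1} := (hW t).mul hplay
  rw [← lintegral_indicator (hE _), lintegral_histLaw_succ M π hθ t _ ((hW _).indicator (hE _)),
    ← lintegral_indicator (hE t), ← lintegral_mul_const _ (hWp.indicator (hE t))]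
  refine lintegral_congr fun H => ?_
  rw [Fin.sum_univ_two]
  have e0 : ∀ x, (starvingHist δ (t + 1)).indicator (rewardWeight ψ)
      (Fin.snoc H ((0 : Fin 2), x)) = 0 := fun x =>
    Set.indicator_of_notMem (by simp [snoc_mem_starvingHist ht]) _
  simp only [e0, lintegral_zero, zero_mul, zero_add]
  by_cases hH : H ∈ starvingHist δ t
  · have e1 : ∀ x, (starvingHist δ (t + 1)).indicator (rewardWeight ψ)
        (Fin.snoc H ((1 : Fin 2), x)) = rewardWeight ψ H * ψ x := fun x => by
      rw [Set.indicator_of_mem ((snoc_mem_starvingHist ht H 1 x).2 ⟨hH, rfl⟩), rewardWeight_snoc]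
    simp only [e1]
    rw [lintegral_const_mul _ hψ, Set.indicator_of_mem hH, mul_right_comm]
  · have e1 : ∀ x, (starvingHist δ (t + 1)).indicator (rewardWeight ψ)
        (Fin.snoc H ((1 : Fin 2), x)) = 0 := fun x =>
      Set.indicator_of_notMem (by simp [snoc_mem_starvingHist ht, hH]) _
    simp only [e1]
    rw [Set.indicator_of_notMem hH]
    simp

theorem thompsonSampling_play_of_lt (M : Model) (prior : Measure (ℝ × ℝ)) [SFinite prior] {t : ℕ}
    (ht : t < 4) : (thompsonSampling M prior 2 2).play t =
      Kernel.const _ (Measure.dirac (Fin.ofNat 2 t)) :=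
  if_pos ht

theorem thompsonSampling_play_of_le (M : Model) (prior : Measure (ℝ × ℝ)) [SFinite prior] {t : ℕ}
    (ht : 4 ≤ t) : (thompsonSampling M prior 2 2).play t = sampledArm M prior 2 t :=
  if_neg (by omega)

theorem lintegral_histLaw_three (M : Model) (prior : Measure (ℝ × ℝ)) [SFinite prior]
    {θ : Fin 2 → ℝ × ℝ} (hθ : ∀ i, θ i ∈ paramSpace) (f : Hist 2 3 → ℝ≥0∞)
    (hf : Measurable f) :
    ∫⁻ H, f H ∂(histLaw M (thompsonSampling M prior 2 2) θ 3) =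
      ∫⁻ x, ∫⁻ y, ∫⁻ z, f ![(0, x), (1, y), (0, z)] ∂(rewardLaw M (θ 0)) ∂(rewardLaw M (θ 1))
        ∂(rewardLaw M (θ 0)) := by
  have hprob := fun a => isProbabilityMeasure_rewardLaw M (hθ a)
  have step : ∀ t < 4, ∀ f : Hist 2 (t + 1) → ℝ≥0∞, Measurable f →
      ∫⁻ H, f H ∂(histLaw M (thompsonSampling M prior 2 2) θ (t + 1)) =
      ∫⁻ H, ∫⁻ x, f (Fin.snoc H (Fin.ofNat 2 t, x)) ∂(rewardLaw M (θ (Fin.ofNat 2 t)))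
        ∂(histLaw M (thompsonSampling M prior 2 2) θ t) := by
    intro t ht f hf
    rw [lintegral_histLaw_succ M _ hθ t f hf]
    refine lintegral_congr fun H => ?_
    rw [Finset.sum_eq_single (Fin.ofNat 2 t)]
    · simp [thompsonSampling_play_of_lt M prior ht]
    · intro a _ ha
      rw [thompsonSampling_play_of_lt M prior ht, Kernel.const_apply, Measure.dirac_apply' _ (measurableSet_singleton a),
        Set.indicator_of_notMem (by simpa using Ne.symm ha), mul_zero]
    · simp
  have hm : ∀ t (g : Hist 2 (t + 1) → ℝ≥0∞) (a : Fin 2), Measurable g →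
      Measurable fun H : Hist 2 t => ∫⁻ x, g (Fin.snoc H (a, x)) ∂(rewardLaw M (θ a)) := by
    intro t g a hg
    exact Measurable.lintegral_prod_right' (f := fun p : Hist 2 t × ℝ => g (Fin.snoc p.1 (a, p.2)))
      (hg.comp (measurable_hist_snoc.comp (f := fun p : Hist 2 t × ℝ => (p.1, (a, p.2)))
        (by fun_prop)))
  rw [step 2 (by norm_num) f hf, step 1 (by norm_num) _ (hm _ _ _ hf),
    step 0 (by norm_num) _ (hm _ _ _ (hm _ _ _ hf)), histLaw,
    lintegral_dirac' _ (hm _ _ _ (hm _ _ _ (hm _ _ _ hf)))]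
  have e0 : Fin.ofNat 2 0 = 0 := rfl
  have e1 : Fin.ofNat 2 1 = 1 := rfl
  have e2 : Fin.ofNat 2 2 = 0 := rfl
  simp only [e0, e1, e2]
  refine lintegral_congr fun x => lintegral_congr fun y => lintegral_congr fun z => ?_
  congr 1
  ext i : 1
  fin_cases i <;> rfl

theorem lintegral_starving_three (M : Model) (prior : Measure (ℝ × ℝ)) [SFinite prior]
    {θ : Fin 2 → ℝ × ℝ} (hθ : ∀ i, θ i ∈ paramSpace) {δ : ℝ} {ψ : ℝ → ℝ≥0∞}
    (hψ : Measurable ψ) :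
    ∫⁻ H in starvingHist δ 3, rewardWeight ψ H ∂(histLaw M (thompsonSampling M prior 2 2) θ 3) =
      (∫⁻ x, ψ x ∂(rewardLaw M (θ 1))) * starvingMass (rewardLaw M (θ 0)) δ := by
  have hprob := fun a => isProbabilityMeasure_rewardLaw M (hθ a)
  have hE := measurableSet_starvingHist δ 3
  have hI : Measurable fun x => rewardLaw M (θ 0) (Set.Ioc x (x + δ)) :=
    measurable_measure_prodMk_left (s := {p : ℝ × ℝ | p.1 < p.2} ∩ {p | p.2 ≤ p.1 + δ})
      ((measurableSet_lt (by fun_prop) (by fun_prop)).inter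
        (measurableSet_le (by fun_prop) (by fun_prop)))
  rw [← lintegral_indicator hE, lintegral_histLaw_three M prior hθ _
    ((measurable_rewardWeight hψ 3).indicator hE), starvingMass,
    ← lintegral_const_mul _ (hI.indicator measurableSet_Icc)]
  refine lintegral_congr fun x => ?_
  rw [← lintegral_mul_const _ hψ]
  refine lintegral_congr fun y => ?_
  by_cases hx : x ∈ Set.Icc (-2 : ℝ) (-(3 / 2))
  · rw [Set.indicator_of_mem hx, ← lintegral_indicator_one measurableSet_Ioc,
      ← lintegral_const_mul _ (measurable_one.indicator measurableSet_Ioc)]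
    refine lintegral_congr fun z => ?_
    have hw : rewardWeight ψ (![(0, x), (1, y), (0, z)] : Hist 2 3) = ψ y := by
      simp [rewardWeight, Fin.prod_univ_three]
    by_cases hz : z ∈ Set.Ioc x (x + δ)
    · rw [Set.indicator_of_mem (three_mem_starvingHist.2 ⟨hx, hz⟩), Set.indicator_of_mem hz, hw]
      simp
    · rw [Set.indicator_of_notMem (fun h => hz (three_mem_starvingHist.1 h).2),
        Set.indicator_of_notMem hz, mul_zero]
  · have e : ∀ z, (starvingHist δ 3).indicator (rewardWeight ψ) ![(0, x), (1, y), (0, z)] = 0 :=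
      fun z => Set.indicator_of_notMem (fun h => hx (three_mem_starvingHist.1 h).1) _
    simp only [e, lintegral_zero]
    rw [Set.indicator_of_notMem hx, mul_zero]

/-- Bounding the probability of playing arm `1` by one decouples its `t - 2` rewards from the
policy. -/
theorem lintegral_starving_le (M : Model) (prior : Measure (ℝ × ℝ)) [SFinite prior]
    {θ : Fin 2 → ℝ × ℝ} (hθ : ∀ i, θ i ∈ paramSpace) {δ : ℝ} {ψ : ℝ → ℝ≥0∞}
    (hψ : Measurable ψ) {t : ℕ} (ht : 3 ≤ t) :
    ∫⁻ H in starvingHist δ t, rewardWeight ψ H ∂(histLaw M (thompsonSampling M prior 2 2) θ t) ≤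
      (∫⁻ x, ψ x ∂(rewardLaw M (θ 1))) ^ (t - 2) * starvingMass (rewardLaw M (θ 0)) δ := by
  induction t, ht using Nat.le_induction with
  | base => simpa using (lintegral_starving_three M prior hθ hψ).le
  | succ t ht ih =>
    have := (thompsonSampling M prior 2 2).markov t
    rw [lintegral_starving_succ M _ hθ hψ ht, show t + 1 - 2 = t - 2 + 1 by omega, pow_succ,
      mul_right_comm]
    gcongr
    refine (lintegral_mono fun H => ?_).trans ih
    exact mul_le_of_le_one_right' prob_le_one

theorem histLaw_starvingHist_le (M : Model) (prior : Measure (ℝ × ℝ)) [SFinite prior]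
    {θ : Fin 2 → ℝ × ℝ} (hθ : ∀ i, θ i ∈ paramSpace) {δ : ℝ} {t : ℕ} (ht : 3 ≤ t) :
    histLaw M (thompsonSampling M prior 2 2) θ t (starvingHist δ t) ≤
      starvingMass (rewardLaw M (θ 0)) δ := by
  have := isProbabilityMeasure_rewardLaw M (hθ 1)
  simpa [rewardWeight_one] using
    lintegral_starving_le M prior hθ (δ := δ) (measurable_const (a := (1 : ℝ≥0∞))) ht

theorem histLaw_starvingHist_succ (M : Model) (prior : Measure (ℝ × ℝ)) [SFinite prior]
    {θ : Fin 2 → ℝ × ℝ} (hθ : ∀ i, θ i ∈ paramSpace) {δ : ℝ} {t : ℕ} (ht : 3 ≤ t) :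
    histLaw M (thompsonSampling M prior 2 2) θ (t + 1) (starvingHist δ (t + 1)) =
      ∫⁻ H in starvingHist δ t, (thompsonSampling M prior 2 2).play t H {1}
        ∂(histLaw M (thompsonSampling M prior 2 2) θ t) := by
  have := isProbabilityMeasure_rewardLaw M (hθ 1)
  simpa [rewardWeight_one] using lintegral_starving_succ M (thompsonSampling M prior 2 2) hθ
    (δ := δ) (measurable_const (a := (1 : ℝ≥0∞))) ht

/-- Round `3` is the last forced play, of arm `1`, so no mass is lost before sampling starts at
round `4`. -/
theorem histLaw_starvingHist_four (M : Model) (prior : Measure (ℝ × ℝ)) [SFinite prior]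
    {θ : Fin 2 → ℝ × ℝ} (hθ : ∀ i, θ i ∈ paramSpace) {δ : ℝ} :
    histLaw M (thompsonSampling M prior 2 2) θ 4 (starvingHist δ 4) =
      starvingMass (rewardLaw M (θ 0)) δ := by
  have := isProbabilityMeasure_rewardLaw M (hθ 1)
  rw [histLaw_starvingHist_succ M prior hθ le_rfl]
  have h3 := lintegral_starving_three M prior hθ (δ := δ) (measurable_const (a := (1 : ℝ≥0∞)))
  simp only [rewardWeight_one, lintegral_const, measure_univ, one_mul] at h3
  rw [← h3]
  simp [thompsonSampling_play_of_lt M prior (t := 3) (by norm_num)]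

theorem le_starvingMass {ν : Measure ℝ} {b : ℝ≥0∞} (hν : ∀ A ⊆ Set.Icc (-2 : ℝ) (-1),
    MeasurableSet A → b * volume A ≤ ν A) {δ : ℝ} (hδ : δ ≤ 1 / 2) :
    b * ENNReal.ofReal δ * (b * ENNReal.ofReal (1 / 2)) ≤ starvingMass ν δ := by
  rw [starvingMass, lintegral_indicator measurableSet_Icc]
  calc _ ≤ b * ENNReal.ofReal δ * ν (Set.Icc (-2 : ℝ) (-(3 / 2))) := by
        gcongr
        refine le_trans (le_of_eq ?_) (hν _ (Set.Icc_subset_Icc_right (by norm_num))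
          measurableSet_Icc)
        rw [Real.volume_Icc]; norm_num
    _ = ∫⁻ x in Set.Icc (-2 : ℝ) (-(3 / 2)), b * ENNReal.ofReal δ ∂ν := by
        rw [setLIntegral_const]
    _ ≤ _ := by
        refine setLIntegral_mono' measurableSet_Icc fun x hx => ?_
        refine le_trans (le_of_eq ?_) (hν _ (fun y hy => ⟨hx.1.trans hy.1.le, ?_⟩)
          measurableSet_Ioc)
        · rw [Real.volume_Ioc]; congr 2; ring
        · linarith [hy.2, hx.2]

/-! ### The samples of the suboptimal arm -/

/-- A weight of the standardized rewards, whose product over a sample controls the spread. -/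
noncomputable def tailWeight : Model → ℝ → ℝ≥0∞
  | Model.uniform, z => if |z| ≤ 1 / 2 then 1 else ∞
  | Model.gaussian, z => ENNReal.ofReal (Real.exp (z ^ 2 / 4))

theorem measurable_tailWeight (M : Model) : Measurable (tailWeight M) := by
  cases M with
  | uniform =>
    exact Measurable.ite (measurableSet_le (by fun_prop) measurable_const) measurable_const
      measurable_const
  | gaussian => unfold tailWeight; fun_prop

/-- The mean of the weight of a standardized reward. -/
noncomputable def meanTailWeight (M : Model) : ℝ≥0∞ := ∫⁻ z, baseDensity M z * tailWeight M z

theorem meanTailWeight_ne_top (M : Model) : meanTailWeight M ≠ ∞ := by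
  cases M with
  | uniform =>
    have : meanTailWeight Model.uniform = 1 := by
      rw [← lintegral_baseDensity Model.uniform]
      refine lintegral_congr fun z => ?_
      simp only [baseDensity, tailWeight]
      by_cases hz : z ∈ Set.Icc (-(1 / 2) : ℝ) (1 / 2)
      · rw [Set.indicator_of_mem hz, if_pos (abs_le.2 hz), mul_one]
      · rw [Set.indicator_of_notMem hz, zero_mul]
    rw [this]; exact ENNReal.one_ne_top
  | gaussian =>
    have hi := (integrable_exp_neg_mul_sq (b := 1 / 4) (by norm_num)).lintegral_lt_top
    refine ne_top_of_le_ne_top hi.ne (lintegral_mono fun z => ?_)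
    simp only [baseDensity, tailWeight, gaussianPDF, gaussianPDFReal]
    rw [← ENNReal.ofReal_mul (by positivity)]
    apply ENNReal.ofReal_le_ofReal
    rw [mul_assoc, ← Real.exp_add]
    have h1 : (√(2 * Real.pi * (1 : NNReal)))⁻¹ ≤ 1 := by simpa using inv_sqrt_two_pi_le_one
    have h2 : -(z - 0) ^ 2 / (2 * ((1 : NNReal) : ℝ)) + z ^ 2 / 4 = -(1 / 4) * z ^ 2 := by
      simp; ring
    rw [h2]
    exact mul_le_of_le_one_left (Real.exp_pos _).le h1

theorem lintegral_tailWeight (M : Model) {ε : ℝ} (hε : 0 < ε) :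
    ∫⁻ x, tailWeight M (x / ε) ∂(rewardLaw M (0, ε)) = meanTailWeight M := by
  have hm : Measurable fun x => tailWeight M (x / ε) := (measurable_tailWeight M).comp (by fun_prop)
  rw [lintegral_rewardLaw M 0 hε _ hm]
  refine lintegral_congr fun z => ?_
  rw [zero_add, mul_div_cancel_left₀ _ hε.ne']

/-- In the uniform model a finite product excludes every reward outside the support. In the Gaussian
model, taking logarithms bounds the mean of `(x s / ε)^2` by `4 l ≤ (4 l)^2`. -/
theorem spreadLE_of_prod_tailWeight_le {ι : Type*} {M : Model} {S : Finset ι} {x : ι → ℝ}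
    {ε l : ℝ} (hε : 0 < ε) (hl : 1 ≤ l)
    (h : ∏ s ∈ S, tailWeight M (x s / ε) ≤ ENNReal.ofReal (Real.exp l) ^ S.card) :
    SpreadLE M S x 0 (4 * l * ε) := by
  cases M with
  | uniform =>
    intro s hs
    by_contra hcon
    push Not at hcon
    have h1 : ∀ r, 1 ≤ tailWeight Model.uniform (x r / ε) := fun r => by
      simp only [tailWeight]; split_ifs <;> simp
    have h2 : tailWeight Model.uniform (x s / ε) = ∞ := by
      simp only [tailWeight]
      rw [if_neg]
      rw [sub_zero] at hcon
      rw [not_le, abs_div, abs_of_pos hε, lt_div_iff₀ hε]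
      nlinarith
    have h3 : ∞ ≤ ∏ s ∈ S, tailWeight Model.uniform (x s / ε) := by
      rw [← h2]
      exact Finset.single_le_prod' (f := fun s => tailWeight Model.uniform (x s / ε))
        (fun r _ => h1 r) hs
    exact absurd (h3.trans h) (by simp [ENNReal.pow_eq_top_iff])
  | gaussian =>
    simp only [tailWeight] at h
    rw [← ENNReal.ofReal_prod_of_nonneg (fun _ _ => by positivity), ← Real.exp_sum,
      ← ENNReal.ofReal_pow (by positivity), ← Real.exp_nat_mul,
      ENNReal.ofReal_le_ofReal_iff (by positivity), Real.exp_le_exp, ← Finset.sum_div] at h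
    change ∑ s ∈ S, (x s - 0) ^ 2 ≤ S.card * (4 * l * ε) ^ 2
    have e : ∑ s ∈ S, (x s - 0) ^ 2 = ε ^ 2 * ∑ s ∈ S, (x s / ε) ^ 2 := by
      rw [Finset.mul_sum]
      refine Finset.sum_congr rfl fun s _ => ?_
      field_simp
      ring
    rw [e]
    have h1 : ∑ s ∈ S, (x s / ε) ^ 2 ≤ S.card * (4 * l) := by linarith
    have h2 : (S.card : ℝ) * (4 * l) ≤ S.card * (4 * l) ^ 2 := by gcongr; nlinarith
    calc ε ^ 2 * ∑ s ∈ S, (x s / ε) ^ 2 ≤ ε ^ 2 * (S.card * (4 * l) ^ 2) := by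
          gcongr; exact h1.trans h2
      _ = _ := by ring

/-! ### The probability of playing the starved arm -/

theorem armRounds_zero_of_starving {δ : ℝ} {t : ℕ} (ht : 3 ≤ t) {H : Hist 2 t}
    (hH : H ∈ starvingHist δ t) :
    armRounds 0 H = {(⟨0, by omega⟩ : Fin t), ⟨2, by omega⟩} := by
  ext s
  simp only [armRounds, Finset.mem_filter, Finset.mem_univ, true_and, hH.1 s, starvingArm,
    Finset.mem_insert, Finset.mem_singleton, Fin.ext_iff]
  split_ifs with h <;> simp [h]

theorem card_armRounds_zero {δ : ℝ} {t : ℕ} (ht : 3 ≤ t) {H : Hist 2 t}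
    (hH : H ∈ starvingHist δ t) : (armRounds 0 H).card = 2 := by
  rw [armRounds_zero_of_starving ht hH, Finset.card_pair (by simp)]

theorem card_armRounds_one {δ : ℝ} {t : ℕ} (ht : 3 ≤ t) {H : Hist 2 t}
    (hH : H ∈ starvingHist δ t) : (armRounds 1 H).card = t - 2 := by
  have h : armRounds 1 H = (armRounds 0 H)ᶜ := by
    ext s
    simp only [armRounds, Finset.mem_filter, Finset.mem_univ, true_and, Finset.mem_compl]
    omega
  rw [h, Finset.card_compl, Fintype.card_fin, card_armRounds_zero ht hH]

theorem spreadLE_pair {ι : Type*} [DecidableEq ι] (M : Model) {r s : ι} (hrs : r ≠ s)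
    {x : ι → ℝ} {δ : ℝ} (h : x s ∈ Set.Ioc (x r) (x r + δ)) :
    SpreadLE M {r, s} x (x r) δ := by
  have h1 : 0 < x s - x r := by linarith [h.1]
  have h2 : x s - x r ≤ δ := by linarith [h.2]
  cases M with
  | uniform =>
    intro i hi
    rw [Finset.mem_insert, Finset.mem_singleton] at hi
    rcases hi with rfl | rfl
    · simp; linarith
    · rwa [abs_of_pos h1]
  | gaussian =>
    change ∑ i ∈ {r, s}, (x i - x r) ^ 2 ≤ (({r, s} : Finset ι).card : ℝ) * δ ^ 2
    rw [Finset.sum_pair hrs, Finset.card_pair hrs]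
    push_cast
    nlinarith

theorem spreadGE_pair {ι : Type*} [DecidableEq ι] (M : Model) {r s : ι} (hrs : r ≠ s)
    (x : ι → ℝ) (μ : ℝ) :
    SpreadGE M {r, s} x μ ((x s - x r) / 2) := by
  cases M with
  | uniform =>
    by_contra hcon
    have hcon' : ∀ i ∈ ({r, s} : Finset ι), |x i - μ| < (x s - x r) / 2 := by
      intro i hi
      by_contra hlt
      exact hcon ⟨i, hi, not_lt.1 hlt⟩
    have h1 := abs_lt.1 (hcon' r (by simp))
    have h2 := abs_lt.1 (hcon' s (by simp))
    linarith [h1.1, h2.2]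
  | gaussian =>
    change (({r, s} : Finset ι).card : ℝ) * ((x s - x r) / 2) ^ 2 ≤ ∑ i ∈ {r, s}, (x i - μ) ^ 2
    rw [Finset.sum_pair hrs, Finset.card_pair hrs]
    push_cast
    nlinarith [sq_nonneg (x r + x s - 2 * μ)]

theorem sampledArm_zero_le_add (M : Model) (prior : Measure (ℝ × ℝ)) [SFinite prior] {t : ℕ}
    (H : Hist 2 t) (y : ℝ) :
    sampledArm M prior 2 t H {0} ≤
      posterior M prior 0 H {θ | y ≤ θ.1} + posterior M prior 1 H {θ | θ.1 ≤ y} := by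
  have hA : MeasurableSet {θ : ℝ × ℝ | y ≤ θ.1} := measurableSet_le measurable_const measurable_fst
  have hB : MeasurableSet {θ : ℝ × ℝ | θ.1 ≤ y} := measurableSet_le measurable_fst measurable_const
  rw [sampledArm, Kernel.map_apply' _ measurable_argmax_fst _ (measurableSet_singleton 0)]
  change Measure.pi (fun i => posterior M prior i H) _ ≤ _
  have e0 := (measurePreserving_eval (fun i : Fin 2 => posterior M prior i H) 0).measure_preimage
    hA.nullMeasurableSet
  have e1 := (measurePreserving_eval (fun i : Fin 2 => posterior M prior i H) 1).measure_preimage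
    hB.nullMeasurableSet
  rw [← e0, ← e1]
  refine (measure_mono ?_).trans (measure_union_le _ _)
  intro p hp
  have h1 : (p 1).1 ≤ (p 0).1 := ((argmax_eq_iff _ _).1 hp).1 1
  rcases le_total y (p 0).1 with h | h
  · exact Or.inl h
  · exact Or.inr (h1.trans h)

theorem sampledArm_zero_le {M : Model} {prior : Measure (ℝ × ℝ)} [SFinite prior] {κ : ℝ≥0∞}
    {k : ℝ} (hp : HasPowerDensity prior κ k) (hκ0 : κ ≠ 0) (hκt : κ ≠ ∞) (hk : 1 ≤ k) {t : ℕ}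
    (ht : 4 ≤ t) {δ D : ℝ} (hδ : 0 < δ) (hδ1 : 8 * δ ≤ 1) (hD : 0 < D) (hD1 : 8 * D ≤ 1)
    {H : Hist 2 t} (hH : H ∈ starvingHist δ t)
    (hx : SpreadLE M (armRounds 1 H) (fun s => (H s).2) 0 D) :
    sampledArm M prior 2 t H {0} ≤ ENNReal.ofReal (128 * δ + 16 * (8 * D) ^ (t - 3)) := by
  have ht3 : 3 ≤ t := by omega
  set r : Fin t := ⟨0, by omega⟩
  set s : Fin t := ⟨2, by omega⟩
  have hrs : r ≠ s := by simp [r, s]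
  have hS : armRounds 0 H = {r, s} := armRounds_zero_of_starving ht3 hH
  have hr := hH.2.1 r rfl
  have hs := hH.2.2 r s rfl rfl
  have hle := spreadLE_pair M hrs (x := fun s => (H s).2) hs
  have hge := spreadGE_pair M hrs (fun s => (H s).2)
  rw [← hS] at hle hge
  have hc0 := card_armRounds_zero ht3 hH
  have hc1 := card_armRounds_one ht3 hH
  have hE0 := evidence_ne_zero hp hκ0 0 H hδ hle
  -- The half-open interval in `starvingHist` makes the gap of the two rewards positive, so the
  -- posterior is not the default one.
  have hEt := evidence_ne_top hp hκt hk 0 H hc0.ge hδ hδ1 hle (half_pos (sub_pos.2 hs.1)) hge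
  have h0 := posterior_far_le hp hk 0 H hc0.ge hδ hδ1 hle hE0 hEt
  have h1 := posterior_far_zero_le hp hk 1 H (by omega) hD hD1 hx
  rw [hc0] at h0
  rw [hc1] at h1
  rw [ENNReal.ofReal_add (by positivity) (by positivity)]
  -- The level `-1/2` is at distance at least `1/2` both from the rewards of arm `0`, the first
  -- being at most `-3/2`, and from the centre `0` of arm `1`. With two observations, `16 * (8δ) =
  -- 128δ`.
  refine (sampledArm_zero_le_add M prior H (-(1 / 2))).trans (add_le_add ?_ ?_)
  · refine (measure_mono ?_).trans (h0.trans (le_of_eq ?_))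
    · intro θ hθ
      have hθ' : -(1 / 2) ≤ θ.1 := hθ
      have : 1 / 2 ≤ θ.1 - (H r).2 := by linarith [hr.2]
      exact this.trans (le_abs_self _)
    · congr 1; norm_num; ring
  · refine (measure_mono ?_).trans (h1.trans (le_of_eq ?_))
    · intro θ hθ
      have hθ' : θ.1 ≤ -(1 / 2) := hθ
      have : 1 / 2 ≤ -θ.1 := by linarith
      exact this.trans (neg_le_abs _)
    · rw [Nat.sub_sub]

/-! ### The starving event has probability of order `1 / t` -/

/-- The mass lost in one round is the probability of playing arm `0`. It is small by posterior
concentration when the samples of arm `1` are typical; atypical samples are paid for by Markov's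
inequality applied to the weight. -/
theorem histLaw_starvingHist_le_succ {M : Model} {prior : Measure (ℝ × ℝ)} [SFinite prior]
    {κ : ℝ≥0∞} {k : ℝ} (hp : HasPowerDensity prior κ k) (hκ0 : κ ≠ 0) (hκt : κ ≠ ∞) (hk : 1 ≤ k)
    {θ : Fin 2 → ℝ × ℝ} (hθ : ∀ i, θ i ∈ paramSpace) {ε : ℝ} (hε : 0 < ε) (hθ1 : θ 1 = (0, ε))
    {l : ℝ} (hl : 1 ≤ l) (hl' : 16 * meanTailWeight M ≤ ENNReal.ofReal (Real.exp l))
    (hεl : 4 * l * ε ≤ 1 / 1024) {δ : ℝ} (hδ : 0 < δ) (hδ1 : 8 * δ ≤ 1) (j : ℕ) :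
    histLaw M (thompsonSampling M prior 2 2) θ (4 + j) (starvingHist δ (4 + j)) ≤
      histLaw M (thompsonSampling M prior 2 2) θ (4 + j + 1) (starvingHist δ (4 + j + 1)) +
        ENNReal.ofReal (128 * δ + 15 / 64 * (1 / 16) ^ j) *
          starvingMass (rewardLaw M (θ 0)) δ := by
  set t := 4 + j with htdef
  have ht : 4 ≤ t := by omega
  set D := 4 * l * ε with hDdef
  have hD : 0 < D := by positivity
  set P := histLaw M (thompsonSampling M prior 2 2) θ
  set Q := starvingMass (rewardLaw M (θ 0)) δ
  set ψ : ℝ → ℝ≥0∞ := fun x => tailWeight M (x / ε) with hψdef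
  have hψ : Measurable ψ := (measurable_tailWeight M).comp (by fun_prop)
  set L := ENNReal.ofReal (Real.exp l)
  have hL0 : L ≠ 0 := by
    rw [← pos_iff_ne_zero, ENNReal.ofReal_pos]; positivity
  have hLt : L ≠ ∞ := ENNReal.ofReal_ne_top
  set β := ENNReal.ofReal (128 * δ + 16 * (8 * D) ^ (t - 3))
  have hmk : IsMarkovKernel ((thompsonSampling M prior 2 2).play t) :=
    (thompsonSampling M prior 2 2).markov t
  -- Either the weight is at most `L^(t - 2)`, and the spread bound applies, or the last term alone
  -- is at least `1`.
  have hpoint : ∀ H ∈ starvingHist δ t, (1 : ℝ≥0∞) ≤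
      (thompsonSampling M prior 2 2).play t H {1} +
        (β + (L ^ (t - 2))⁻¹ * rewardWeight ψ H) := by
    intro H hH
    have hsum : (thompsonSampling M prior 2 2).play t H {1} +
        (thompsonSampling M prior 2 2).play t H {0} = 1 := by
      have := sum_measure_singleton (μ := (thompsonSampling M prior 2 2).play t H)
        (s := (Finset.univ : Finset (Fin 2)))
      rw [Fin.sum_univ_two, add_comm] at this
      rw [this]; simp
    rw [← hsum]
    gcongr
    by_cases hw : rewardWeight ψ H ≤ L ^ (t - 2)
    · refine le_add_right ?_
      rw [thompsonSampling_play_of_le M prior ht]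
      refine sampledArm_zero_le hp hκ0 hκt hk ht hδ hδ1 hD (by linarith) hH ?_
      apply spreadLE_of_prod_tailWeight_le hε hl
      rw [card_armRounds_one (by omega) hH]
      rwa [rewardWeight_eq_prod] at hw
    · refine le_add_left (prob_le_one.trans ?_)
      rw [mul_comm, ← div_eq_mul_inv, ENNReal.le_div_iff_mul_le (Or.inl (pow_ne_zero _ hL0))
        (Or.inl (ENNReal.pow_ne_top hLt)), one_mul]
      exact (not_le.1 hw).le
  have hW := measurable_rewardWeight hψ t
  have hplay : Measurable fun H => (thompsonSampling M prior 2 2).play t H {1} :=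
    Kernel.measurable_coe _ (measurableSet_singleton 1)
  have hweight : (L ^ (t - 2))⁻¹ * ∫⁻ H in starvingHist δ t, rewardWeight ψ H ∂(P t) ≤
      ENNReal.ofReal ((1 / 16) ^ (t - 2)) * Q := by
    calc _ ≤ (L ^ (t - 2))⁻¹ * (meanTailWeight M ^ (t - 2) * Q) := by
          gcongr
          have := lintegral_starving_le M prior hθ (δ := δ) hψ (t := t) (by omega)
          rwa [hθ1, lintegral_tailWeight M hε] at this
      _ = ((meanTailWeight M) / L) ^ (t - 2) * Q := by
          rw [← mul_assoc, ENNReal.inv_pow, ← mul_pow, mul_comm L⁻¹, div_eq_mul_inv]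
      _ ≤ (ENNReal.ofReal (1 / 16)) ^ (t - 2) * Q := by
          gcongr
          rw [ENNReal.div_le_iff hL0 hLt]
          have h16 : ENNReal.ofReal (1 / 16) * 16 = 1 := by
            rw [show (16 : ℝ≥0∞) = ENNReal.ofReal 16 by simp, ← ENNReal.ofReal_mul (by norm_num)]
            norm_num
          calc meanTailWeight M = ENNReal.ofReal (1 / 16) * (16 * meanTailWeight M) := by
                rw [← mul_assoc, h16, one_mul]
            _ ≤ _ := by gcongr
      _ = _ := by rw [ENNReal.ofReal_pow (by norm_num)]
  calc P t (starvingHist δ t) = ∫⁻ H in starvingHist δ t, 1 ∂(P t) := by simp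
    _ ≤ ∫⁻ H in starvingHist δ t, ((thompsonSampling M prior 2 2).play t H {1} +
        (β + (L ^ (t - 2))⁻¹ * rewardWeight ψ H)) ∂(P t) :=
        setLIntegral_mono' (measurableSet_starvingHist δ t) hpoint
    _ = P (t + 1) (starvingHist δ (t + 1)) + (β * P t (starvingHist δ t) +
        (L ^ (t - 2))⁻¹ * ∫⁻ H in starvingHist δ t, rewardWeight ψ H ∂(P t)) := by
        rw [lintegral_add_left hplay, lintegral_add_left measurable_const,
          lintegral_const_mul _ hW, setLIntegral_const,
          ← histLaw_starvingHist_succ M prior hθ (by omega)]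
    _ ≤ P (t + 1) (starvingHist δ (t + 1)) +
        (β * Q + ENNReal.ofReal ((1 / 16) ^ (t - 2)) * Q) := by
        gcongr
        exact histLaw_starvingHist_le M prior hθ (by omega)
    _ ≤ _ := by
        rw [← add_mul, ← ENNReal.ofReal_add (by positivity) (by positivity)]
        refine add_le_add le_rfl (mul_le_mul_left (ENNReal.ofReal_le_ofReal ?_) Q)
        -- The two geometric terms sum to at most `(1/8 + 1/256) (1/16)^j`. The larger constant
        -- `15/64 = (1/4)(1 - 1/16)` makes the losses telescope to less than `1/4`.
        have h1 : (8 * D) ^ (t - 3) ≤ 1 / 128 * (1 / 16) ^ j := by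
          rw [show t - 3 = j + 1 by omega, pow_succ']
          gcongr <;> linarith
        have h2 : ((1 : ℝ) / 16) ^ (t - 2) = 1 / 256 * (1 / 16) ^ j := by
          rw [show t - 2 = 2 + j by omega, pow_add]; norm_num
        have h3 : (0 : ℝ) ≤ (1 / 16) ^ j := by positivity
        rw [h2]
        linarith

/-- The accumulated loss is at most the fraction `128 δ j + 1/4 ≤ 1/2` of the initial mass, so at
least half of it remains. -/
theorem starvingMass_le_two_mul {M : Model} {prior : Measure (ℝ × ℝ)} [SFinite prior]
    {κ : ℝ≥0∞} {k : ℝ} (hp : HasPowerDensity prior κ k) (hκ0 : κ ≠ 0) (hκt : κ ≠ ∞) (hk : 1 ≤ k)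
    {θ : Fin 2 → ℝ × ℝ} (hθ : ∀ i, θ i ∈ paramSpace) {ε : ℝ} (hε : 0 < ε) (hθ1 : θ 1 = (0, ε))
    {l : ℝ} (hl : 1 ≤ l) (hl' : 16 * meanTailWeight M ≤ ENNReal.ofReal (Real.exp l))
    (hεl : 4 * l * ε ≤ 1 / 1024) {δ : ℝ} (hδ : 0 < δ) (hδ1 : 8 * δ ≤ 1) {j : ℕ}
    (hj : 128 * δ * j ≤ 1 / 4) :
    starvingMass (rewardLaw M (θ 0)) δ ≤
      2 * histLaw M (thompsonSampling M prior 2 2) θ (4 + j) (starvingHist δ (4 + j)) := by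
  have key : ∀ j : ℕ, starvingMass (rewardLaw M (θ 0)) δ ≤
      histLaw M (thompsonSampling M prior 2 2) θ (4 + j) (starvingHist δ (4 + j)) +
        ENNReal.ofReal (128 * δ * j + 1 / 4 * (1 - (1 / 16) ^ j)) *
          starvingMass (rewardLaw M (θ 0)) δ := by
    intro j
    induction j with
    | zero => exact le_add_right (histLaw_starvingHist_four M prior hθ).ge
    | succ j ih =>
      have hpow : ((1 : ℝ) / 16) ^ j ≤ 1 := pow_le_one₀ (by norm_num) (by norm_num)
      refine ih.trans ((add_le_add_left (histLaw_starvingHist_le_succ hp hκ0 hκt hk hθ hε hθ1 hl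
        hl' hεl hδ hδ1 j) _).trans (le_of_eq ?_))
      rw [add_assoc, ← add_mul, ← ENNReal.ofReal_add (by positivity)
        (add_nonneg (by positivity) (mul_nonneg (by norm_num) (by linarith)))]
      congr 3
      push_cast
      ring
  set Q := starvingMass (rewardLaw M (θ 0)) δ
  set P := histLaw M (thompsonSampling M prior 2 2) θ
  have := isProbabilityMeasure_histLaw M (thompsonSampling M prior 2 2) hθ 4
  have hQ : Q ≠ ∞ := by
    have h4 : P 4 (starvingHist δ 4) = Q := (histLaw_starvingHist_four M prior hθ (δ := δ))
    exact h4 ▸ measure_ne_top _ _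
  have h1 : Q ≤ P (4 + j) (starvingHist δ (4 + j)) + Q / 2 := by
    refine (key j).trans ?_
    gcongr
    rw [ENNReal.div_eq_inv_mul]
    gcongr
    rw [show (2 : ℝ≥0∞)⁻¹ = ENNReal.ofReal (1 / 2) by
      rw [one_div, ENNReal.ofReal_inv_of_pos (by norm_num)]; simp]
    apply ENNReal.ofReal_le_ofReal
    have : (0 : ℝ) ≤ (1 / 16) ^ j := by positivity
    linarith
  conv_lhs at h1 => rw [← ENNReal.add_halves Q]
  have h2 := (ENNReal.add_le_add_iff_right (ENNReal.div_ne_top hQ (by norm_num))).1 h1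
  rwa [ENNReal.div_le_iff' (by norm_num) (by norm_num)] at h2

/-! ### Hard instances and logarithmic regret -/

theorem exists_le_starvingMass (M : Model) :
    ∃ b > 0, ∀ δ : ℝ, 0 < δ → δ ≤ 1 / 2 →
      ENNReal.ofReal (b * δ) ≤ starvingMass (rewardLaw M (1, 8)) δ := by
  -- The density increases up to `1`, so `q` is its minimum on `[-2, -1]`. The scale `8` puts this
  -- interval inside the uniform support `[-3, 5]`.
  set q := density M (1, 8) (-2) with hq
  have hqt : q ≠ ∞ := density_ne_top M _ _
  have hq0 : q ≠ 0 := by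
    have hb : baseDensity M ((-2 - 1) / 8) ≠ 0 := by
      cases M with
      | uniform =>
        simp only [baseDensity]
        rw [Set.indicator_of_mem (by constructor <;> norm_num)]
        exact one_ne_zero
      | gaussian => exact (gaussianPDF_pos 0 one_ne_zero _).ne'
    refine mul_ne_zero ?_ hb
    rw [← pos_iff_ne_zero, ENNReal.ofReal_pos]; norm_num
  have hpos : 0 < q.toReal := ENNReal.toReal_pos hq0 hqt
  refine ⟨q.toReal ^ 2 / 2, by positivity, fun δ hδ hδ2 => ?_⟩
  refine le_trans (le_of_eq ?_) (le_starvingMass (b := q) (fun A hA hAm => ?_) hδ2)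
  · conv_rhs => rw [← ENNReal.ofReal_toReal hqt]
    rw [← ENNReal.ofReal_mul hpos.le, ← ENNReal.ofReal_mul hpos.le,
      ← ENNReal.ofReal_mul (by positivity)]
    congr 1
    ring
  · rw [rewardLaw, withDensity_apply _ hAm, ← setLIntegral_const]
    exact setLIntegral_mono' hAm fun x hx =>
      density_mono M (by norm_num) (hA hx).1 (by linarith [(hA hx).2])

/-- The two-armed instances on which Thompson sampling is shown to be suboptimal. -/
noncomputable def twoArms (ε : ℝ) : Fin 2 → ℝ × ℝ := ![(1, 8), (0, ε)]

theorem twoArms_mem {ε : ℝ} (hε : 0 < ε) (i : Fin 2) : twoArms ε i ∈ paramSpace := by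
  fin_cases i
  · exact ⟨trivial, by simp [twoArms]⟩
  · exact ⟨trivial, by simpa [twoArms] using hε⟩

theorem expectedRegret_succ_ge (M : Model) (prior : Measure (ℝ × ℝ)) [SFinite prior] {ε : ℝ}
    (hε : 0 < ε) (δ : ℝ) {T : ℕ} (hT : 3 ≤ T) :
    expectedRegret M (thompsonSampling M prior 2 2) (twoArms ε) 0 T +
        histLaw M (thompsonSampling M prior 2 2) (twoArms ε) (T + 1) (starvingHist δ (T + 1)) ≤
      expectedRegret M (thompsonSampling M prior 2 2) (twoArms ε) 0 (T + 1) := by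
  rw [expectedRegret_succ M _ (twoArms_mem hε)]
  gcongr
  rw [← lintegral_indicator_one (measurableSet_starvingHist δ (T + 1))]
  refine lintegral_mono fun H => ?_
  by_cases hH : H ∈ starvingHist δ (T + 1)
  swap
  · rw [Set.indicator_of_notMem hH]; exact zero_le
  have h := hH.1 (Fin.last T)
  have h0 : T ≠ 0 := by omega
  have h2 : T ≠ 2 := by omega
  simp only [Fin.val_last, starvingArm, h0, h2, or_self, if_false] at h
  rw [Set.indicator_of_mem hH, h]
  simp [twoArms]

/-- The regret on the instances `twoArms ε` grows at a logarithmic rate independent of `ε`. -/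
theorem exists_log_le_expectedRegret {M : Model} {prior : Measure (ℝ × ℝ)} [SFinite prior]
    {κ : ℝ≥0∞} {k : ℝ} (hp : HasPowerDensity prior κ k) (hκ0 : κ ≠ 0) (hκt : κ ≠ ∞)
    (hk : 1 ≤ k) :
    ∃ b > 0, ∃ ε₀ > 0, ∀ ε, 0 < ε → ε ≤ ε₀ → ∀ T : ℕ, 4 ≤ T →
      ENNReal.ofReal (b * (Real.log T - Real.log 4)) ≤
        expectedRegret M (thompsonSampling M prior 2 2) (twoArms ε) 0 T := by
  obtain ⟨b, hb, hQ⟩ := exists_le_starvingMass M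
  set l := 16 * (meanTailWeight M).toReal + 1 with hldef
  have hw : 0 ≤ (meanTailWeight M).toReal := ENNReal.toReal_nonneg
  have hl : 1 ≤ l := by linarith
  have hl' : 16 * meanTailWeight M ≤ ENNReal.ofReal (Real.exp l) := by
    rw [← ENNReal.ofReal_toReal (meanTailWeight_ne_top M),
      show (16 : ℝ≥0∞) = ENNReal.ofReal 16 by simp, ← ENNReal.ofReal_mul (by norm_num)]
    apply ENNReal.ofReal_le_ofReal
    linarith [Real.add_one_le_exp l]
  -- Half of the mass `b δ` at `δ = 1 / (512 T)` is `b / (1024 T)`; here `b` involves only the arm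
  -- `(1, 8)`, hence not `ε`.
  refine ⟨b / 1024, by positivity, 1 / (4096 * l), by positivity, fun ε hε hε0 T hT => ?_⟩
  have hεl : 4 * l * ε ≤ 1 / 1024 := by
    rw [le_div_iff₀ (by positivity)] at hε0
    linarith
  induction T, hT using Nat.le_induction with
  | base => simp
  | succ T hT ih =>
    have hT' : (4 : ℝ) ≤ T := by exact_mod_cast hT
    have hT0 : (0 : ℝ) < T := by linarith
    -- A new `δ` is used for each round, chosen so that `128 δ T = 1/4`.
    set δ : ℝ := 1 / (512 * T)
    have hδ : 0 < δ := by positivity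
    have hδ1 : 8 * δ ≤ 1 := by
      rw [mul_one_div, div_le_one (by positivity)]; linarith
    have hj : 128 * δ * ((T - 3 : ℕ) : ℝ) ≤ 1 / 4 := by
      rw [Nat.cast_sub (by omega), mul_one_div, div_mul_eq_mul_div, div_le_iff₀ (by positivity)]
      push_cast
      linarith
    have hstarve := starvingMass_le_two_mul hp hκ0 hκt hk (twoArms_mem hε) hε rfl hl hl' hεl hδ
      hδ1 hj
    rw [show 4 + (T - 3) = T + 1 by omega] at hstarve
    have hmass := (hQ δ hδ (by linarith)).trans hstarve
    have hprob : ENNReal.ofReal (b / 1024 * (1 / T)) ≤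
        histLaw M (thompsonSampling M prior 2 2) (twoArms ε) (T + 1)
          (starvingHist δ (T + 1)) := by
      refine (ENNReal.mul_le_mul_iff_right (a := 2) (by norm_num) (by norm_num)).1
        (le_trans (le_of_eq ?_) hmass)
      rw [show (2 : ℝ≥0∞) = ENNReal.ofReal 2 by simp, ← ENNReal.ofReal_mul (by norm_num)]
      congr 1
      simp only [δ]
      field_simp
      norm_num
    refine le_trans ?_ ((add_le_add ih hprob).trans
      (expectedRegret_succ_ge M prior hε δ (by omega)))
    have hlog4 : Real.log 4 ≤ Real.log T := Real.log_le_log (by norm_num) hT'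
    rw [← ENNReal.ofReal_add (mul_nonneg (by positivity) (by linarith)) (by positivity), ← mul_add]
    apply ENNReal.ofReal_le_ofReal
    gcongr
    have h := Real.log_le_sub_one_of_pos (x := (T + 1) / T) (by positivity)
    rw [Real.log_div (by positivity) (by positivity)] at h
    have e : ((T : ℝ) + 1) / T - 1 = 1 / T := by field_simp; ring
    push_cast
    linarith

/-! ### Comparison with the lower bound -/

theorem lowerBound_twoArms_le {M : Model} {ε Λ : ℝ} (hΛ : 0 < Λ)
    (h : ∀ η ∈ paramSpace, 1 < η.1 →
      ENNReal.ofReal Λ ≤ InformationTheory.klDiv (rewardLaw M (0, ε)) (rewardLaw M η)) :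
    lowerBound M (twoArms ε) 0 ≤ ENNReal.ofReal Λ⁻¹ := by
  have e : (Finset.univ.erase (0 : Fin 2)) = {1} := by decide
  rw [lowerBound, e, Finset.sum_singleton, ENNReal.ofReal_inv_of_pos hΛ, ← one_div]
  refine ENNReal.div_le_div (by simp [twoArms]) (le_iInf₂ fun η hη => ?_)
  exact h η hη.1 (by simpa [twoArms] using hη.2)

theorem initialPlays_eq_two {k : ℝ} (hk : 1 ≤ k) : initialPlays k = 2 := by
  have h : 1 ≤ ⌈k⌉ := Int.one_le_ceil_iff.2 (by linarith)
  have : max 2 (3 - ⌈k⌉) = 2 := max_eq_left (by linarith)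
  simp [initialPlays, this]

theorem not_isAsymptoticallyOptimal_of_hasPowerDensity {M : Model} {prior : Measure (ℝ × ℝ)}
    [SFinite prior] {κ : ℝ≥0∞} {k : ℝ} (hp : HasPowerDensity prior κ k) (hκ0 : κ ≠ 0)
    (hκt : κ ≠ ∞) (hk : 1 ≤ k) :
    ¬ IsAsymptoticallyOptimal M (fun K _ => thompsonSampling M prior 2 K) := by
  intro hopt
  obtain ⟨b, hb, ε₁, hε₁, hreg⟩ := exists_log_le_expectedRegret (M := M) hp hκ0 hκt hk
  -- With `Λ = 4 / b` the lower bound is at most `b / 4`. The regret rate is at least `b / 2`, since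
  -- `log T - log 4 ≥ (log T) / 2` for `T ≥ 16`.
  obtain ⟨ε₂, hε₂, hkl⟩ := exists_forall_le_klDiv M (4 / b) (by positivity)
  set ε := min ε₁ ε₂
  have hε : 0 < ε := lt_min hε₁ hε₂
  have h := hopt 2 (twoArms ε) 0 (twoArms_mem hε) (fun i hi => by
    fin_cases i
    · exact absurd rfl hi
    · simp [twoArms])
  have hlow := lowerBound_twoArms_le (M := M) (by positivity)
    (hkl ε hε (min_le_right _ _))
  have hlim : ENNReal.ofReal (b / 2) ≤ limsup (fun T : ℕ =>
      expectedRegret M (thompsonSampling M prior 2 2) (twoArms ε) 0 T /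
        ENNReal.ofReal (Real.log (T : ℝ))) atTop := by
    refine le_trans (le_liminf_of_le (by isBoundedDefault) ?_)
      (liminf_le_limsup (by isBoundedDefault) (by isBoundedDefault))
    filter_upwards [eventually_ge_atTop 16] with T hT
    have hT' : (16 : ℝ) ≤ T := by exact_mod_cast hT
    have hlog : 0 < Real.log T := Real.log_pos (by linarith)
    rw [ENNReal.le_div_iff_mul_le (Or.inl (ENNReal.ofReal_pos.2 hlog).ne')
      (Or.inl ENNReal.ofReal_ne_top), ← ENNReal.ofReal_mul (by positivity)]
    refine le_trans (ENNReal.ofReal_le_ofReal ?_) (hreg ε hε (min_le_left _ _) T (by omega))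
    have h16 : 2 * Real.log 4 ≤ Real.log T := by
      have : Real.log 16 = 2 * Real.log 4 := by
        rw [show (16 : ℝ) = 4 ^ 2 by norm_num, Real.log_pow]; norm_num
      rw [← this]
      exact Real.log_le_log (by norm_num) hT'
    nlinarith
  have hcontra := (hlim.trans h).trans hlow
  rw [ENNReal.ofReal_le_ofReal_iff (by positivity), inv_div] at hcontra
  linarith

end LSBandit

theorem corollary3 (g h : ℝ → ℝ) (c d k : ℝ) (hk : 1 ≤ k)
    (hg_inj : Function.Injective g) (hh_inj : Set.InjOn h (Set.Ioi 0))
    (hg : ∀ μ : ℝ, HasDerivAt g c μ)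
    (hh : ∀ σ : ℝ, 0 < σ → HasDerivAt h (d * σ ^ (-k)) σ)
    (M : LSBandit.Model) :
    ¬ LSBandit.IsAsymptoticallyOptimal M
        (fun K _ => LSBandit.thompsonSampling M (LSBandit.uniformPrior g h)
          (LSBandit.initialPlays k) K) := by
  rw [LSBandit.initialPlays_eq_two hk]
  refine LSBandit.not_isAsymptoticallyOptimal_of_hasPowerDensity
    (LSBandit.lintegral_uniformPrior hg_inj hh_inj hg hh) ?_ ENNReal.ofReal_ne_top hk
  rw [← pos_iff_ne_zero, ENNReal.ofReal_pos, abs_pos]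
  exact mul_ne_zero (LSBandit.ne_zero_of_injective_of_hasDerivAt hg_inj hg)
    (LSBandit.ne_zero_of_injOn_of_hasDerivAt hh_inj hh)
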